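/- **Setting.** Let $d\ge 1$ be an integer, $a_0>0$, $L>0$ and $0<\underline c<\bar c<\infty$. Let $X_1,\dots,X_n$ be i.i.d. random vectors in $\mathbb R^d$ with a probability density $p$ such that $\|p\|_\infty\le L$. Let $\|\cdot\|$ be the norm of $L_2(\mathbb R^d)$. For an estimator $\hat p$ based on a sample of size $n$ put $R_n(\hat p,p)=E\|\hat p-p\|^2$. For $K\in L_2(\mathbb R^d)$ and $h>0$ let $$\hat p_{m,h,K}(x)=\frac1{mh^d}\sum_{i=1}^m K\Big(\frac{Z_i-x}{h}\Big)$$ be the kernel estimator based on a sample $(Z_1,\dots,Z_m)$. **Kernels.** Let $\mathcal K=\{K_{(1)},\dots,K_{(N)}\}\subset L_2(\mathbb R^d)$, $N\ge 1$, be real-valued kernels with $\underline c<\|K_{(j)}\|<\bar c$ for all $j$, such that for each $K\in\mathcal K$ a version of the $L_2$ Fourier transform $\mathcal F[K](t)=\int e^{ix^Tt}K(x)\,dx$ takes values in $[0,1]$ and satisfies $\mathcal F[K](h't)\ge\mathcal F[K](ht)$ for all $t\in\mathbb R^d$ and $h>h'>0$. **Grid and splits.** For $n\ge4$ let $h_0=(n\log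 n)^{-1/d}$, $a_n=a_0/\log n$, $M-2=\max\{j\in\mathbb N: h_0(1+a_n)^j<1\}$ (with $0\in\mathbb N$), $h_j=(1+a_n)^jh_0$ for $1\le j\le M-2$, $h_{M-1}=1$, and $\mathcal H=\{h_0,\dots,h_{M-1}\}$. Let $m=\lfloor n(1-1/\log n)\rfloor$ and $\ell=n-m$. Let $\mathbf S$ be any nonempty finite set of splits of the sample into a training sample of size $m$ and a validation sample $(Y_1,\dots,Y_\ell)$ of size $\ell$. **Aggregates.** Given functions $f_1,\dots,f_{M'}\in L_2(\mathbb R^d)$: - a *linear aggregate* is $\sum_k\big(\frac1\ell\sum_{i=1}^\ell\phi_k(Y_i)\big)\phi_k$, where $(\phi_k)$ is an orthonormal basis in $L_2(\mathbb R^d)$ of the linear span of the $f_j$; - a *convex aggregate* is $\sum_j\hat\lambda_jf_j$, where $\hat\lambda$ minimizes $\big\|\sum_j\lambda_jf_j\big\|^2-\frac2\ell\sum_{i=1}^\ell\sum_j\lambda_jf_j(Y_i)$ over $\{\lambda\in\mathbb R^{M'}:\lambda_j\ge0,\ \sum_j\lambda_j\le1\}$. Let $\tilde p_n^{\mathbf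 S,\mathcal K}$ be the average over the splits in $\mathbf S$ of the linear aggregates (or, alternatively, the average of the convex aggregates) of the $NM$ functions $\hat p_{m,h,K}$, $K\in\mathcal K$, $h\in\mathcal H$, where these functions are computed from the training sample and aggregated with the validation sample of each split. **Corollary 6.2.** There exist an integer $n_1=n_1(L,\underline c,\bar c)\ge4$ depending only on $L,\underline c,\bar c$, a constant $c_5>0$ depending only on $d$ and $a_0$, and a constant $c_7>0$ depending only on $L,\underline c,\bar c,d$ and $a_0$, such that for all $p$, $N$, $\mathcal K$, $\mathbf S$ as above, for both types of aggregation, and for all $n\ge n_1$, $$R_n(\tilde p_n^{\mathbf S,\mathcal K},p)\le\Big(1+\frac{c_5}{\log n}\Big)\min_{K\in\mathcal K}\inf_{h>0}R_n(\hat p_{n,h,K},p)+c_7\,\frac{N(\log n)^3}{n}.$$ -/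

import Mathlib

open MeasureTheory
open scoped ENNReal FourierTransform

noncomputable section

namespace DensityAggregation

/-- The space `ℝ^d` with its Euclidean structure. -/
abbrev Space (d : ℕ) := EuclideanSpace ℝ (Fin d)

/-! ### Densities, estimators and risk -/

/-- The class of probability densities on `ℝ^d` whose `L_∞` norm is at most `L`. -/
structure IsBoundedDensity (d : ℕ) (L : ℝ) (p : Space d → ℝ) : Prop where
  nonneg : ∀ x, 0 ≤ p x
  integrable : Integrable p volume
  integral_eq_one : ∫ x, p x = 1
  bound : eLpNorm p ∞ volume ≤ ENNReal.ofReal L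

/-- The law of a sample of `n` independent random vectors with density `p`. -/
def sampleLaw {d : ℕ} (n : ℕ) (p : Space d → ℝ) : Measure (Fin n → Space d) :=
  Measure.pi fun _ => volume.withDensity fun x => ENNReal.ofReal (p x)

/-- The risk `R_n(T, p)`: the expectation of the squared `L_2` distance between the estimator `T`,
a function of the sample with values in the functions on `ℝ^d`, and `p`. It takes values in
`[0, ∞]`, so that an upper bound on it contains the assertion that the risk is finite. -/
def risk {d n : ℕ} (T : (Fin n → Space d) → Space d → ℝ) (p : Space d → ℝ) : ℝ≥0∞ :=
  ∫⁻ X, (∫⁻ x, ENNReal.ofReal ((T X x - p x) ^ 2)) ∂(sampleLaw n p)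

/-- The norm of a function in `L_2(ℝ^d)`. -/
def l2Norm {d : ℕ} (f : Space d → ℝ) : ℝ := (eLpNorm f 2 volume).toReal

/-! ### Linear and convex aggregates of frozen functions -/

/-- `T`, a function of a sample of size `l`, is a linear aggregate of the functions `f j`:
`φ` is an orthonormal basis in `L_2` of the linear span of the `f j`, and `T` is the projection
estimator `∑ k, (1/l) (∑ i, φ k (Y i)) φ k`. -/
def IsLinearAggregate {d l : ℕ} {ι : Type} [Fintype ι] (f : ι → Space d → ℝ)
    (T : (Fin l → Space d) → Space d → ℝ) : Prop :=
  ∃ (r : ℕ) (φ : Fin r → Space d → ℝ),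
    (∀ k, φ k ∈ Submodule.span ℝ (Set.range f)) ∧
    (∀ i k, ∫ x, φ i x * φ k x = if i = k then 1 else 0) ∧
    (∀ j, ∃ c : Fin r → ℝ, f j =ᵐ[volume] fun x => ∑ k, c k * φ k x) ∧
    ∀ Y x, T Y x = ∑ k, ((1 / (l : ℝ)) * ∑ i, φ k (Y i)) * φ k x

/-- The combination `∑ j, λ j f j`. -/
def combination {d : ℕ} {ι : Type} [Fintype ι] (f : ι → Space d → ℝ) (w : ι → ℝ) :
    Space d → ℝ :=
  fun x => ∑ j, w j * f j x

/-- The simplex of nonnegative weights with sum at most one. -/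
def weightSimplex (ι : Type) [Fintype ι] : Set (ι → ℝ) :=
  {w | (∀ j, 0 ≤ w j) ∧ ∑ j, w j ≤ 1}

/-- The empirical criterion `‖f_λ‖² - (2/l) ∑ i, f_λ (Y i)`. -/
def criterion {d l : ℕ} {ι : Type} [Fintype ι] (f : ι → Space d → ℝ) (Y : Fin l → Space d)
    (w : ι → ℝ) : ℝ :=
  (∫ x, (combination f w x) ^ 2) - (2 / (l : ℝ)) * ∑ i, combination f w (Y i)

/-- `T`, a function of a sample of size `l`, is a convex aggregate of the functions `f j`:
its weights minimize the empirical criterion over the simplex. -/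
def IsConvexAggregate {d l : ℕ} {ι : Type} [Fintype ι] (f : ι → Space d → ℝ)
    (T : (Fin l → Space d) → Space d → ℝ) : Prop :=
  ∃ w : (Fin l → Space d) → ι → ℝ, ∀ Y,
    w Y ∈ weightSimplex ι ∧
    (∀ v ∈ weightSimplex ι, criterion f Y (w Y) ≤ criterion f Y v) ∧
    T Y = combination f (w Y)

/-- The two kinds of aggregation. -/
inductive Kind where
  | linear
  | convex

/-- `T` is an aggregate, of the given kind, of the functions `f j`. -/
def IsAggregate {d l : ℕ} {ι : Type} [Fintype ι] (kind : Kind) (f : ι → Space d → ℝ)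
    (T : (Fin l → Space d) → Space d → ℝ) : Prop :=
  match kind with
  | .linear => IsLinearAggregate f T
  | .convex => IsConvexAggregate f T

/-! ### Sample splitting -/

/-- A split of a sample of size `n` into a training sample of size `m` and a validation sample
of size `l`. -/
abbrev Split (n m l : ℕ) := (Fin m ⊕ Fin l) ≃ Fin n

/-- The training sample of a split. -/
def Split.train {d n m l : ℕ} (S : Split n m l) (X : Fin n → Space d) : Fin m → Space d :=
  fun i => X (S (Sum.inl i))

/-- The validation sample of a split. -/
def Split.valid {d n m l : ℕ} (S : Split n m l) (X : Fin n → Space d) : Fin l → Space d :=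
  fun i => X (S (Sum.inr i))

/-- `T` is an averaged aggregate over the set of splits `𝒮` of the initial estimators `f j`, which
are functions of a sample of size `m`: it is the mean over the splits of aggregates based on the
validation sample, of the initial estimators based on the training sample. -/
def IsAveragedAggregate {d n m l : ℕ} {ι : Type} [Fintype ι] (kind : Kind)
    (𝒮 : Finset (Split n m l)) (f : ι → (Fin m → Space d) → Space d → ℝ)
    (T : (Fin n → Space d) → Space d → ℝ) : Prop :=
  ∃ A : Split n m l → (Fin m → Space d) → (Fin l → Space d) → Space d → ℝ,
    (∀ S ∈ 𝒮, ∀ Z, IsAggregate kind (fun j => f j Z) (A S Z)) ∧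
    ∀ X x, T X x = (1 / (𝒮.card : ℝ)) * ∑ S ∈ 𝒮, A S (S.train X) (S.valid X) x

/-! ### Kernel estimators -/

/-- The kernel density estimator with kernel `K` and bandwidth `h` from a sample of size `m`. -/
def kernelEstimator {d m : ℕ} (K : Space d → ℝ) (h : ℝ) (Z : Fin m → Space d) : Space d → ℝ :=
  fun x => (1 / ((m : ℝ) * h ^ d)) * ∑ i, K (h⁻¹ • (Z i - x))

/-- `Φ` is a version of the Fourier transform `t ↦ ∫ exp(i xᵀ t) K(x) dx`, extended to `L_2`, of
the square integrable function `K`. The Fourier transform `𝓕` of Mathlib has the phase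
`exp(-2π i xᵀ ξ)`, hence the change of variable `ξ = -t/(2π)`. -/
def IsFourierVersion {d : ℕ} (K Φ : Space d → ℝ) : Prop :=
  ∃ hK : MemLp (fun x => (K x : ℂ)) 2 (volume : Measure (Space d)),
    (fun t : Space d => (𝓕 (hK.toLp _) : Lp ℂ 2 (volume : Measure (Space d)))
      ((-(2 * Real.pi)⁻¹) • t)) =ᵐ[volume] fun t => (Φ t : ℂ)

/-- Kernels in `L_2` having a version of the Fourier transform with values in `[0, 1]` that is
nonincreasing along rays from the origin. -/
def IsAdmissibleKernel {d : ℕ} (K : Space d → ℝ) : Prop :=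
  MemLp K 2 volume ∧ ∃ Φ : Space d → ℝ, IsFourierVersion K Φ ∧
    (∀ t, 0 ≤ Φ t ∧ Φ t ≤ 1) ∧
    ∀ (t : Space d) (h h' : ℝ), 0 < h' → h' < h → Φ (h • t) ≤ Φ (h' • t)

/-! ### The grid of bandwidths and the sizes of the subsamples -/

/-- `h_0 = (n log n)^{-1/d}`. -/
def smallestBandwidth (d n : ℕ) : ℝ := ((n : ℝ) * Real.log n) ^ (-(1 / (d : ℝ)))

/-- `1 + a_n = 1 + a_0 / log n`. -/
def gridStep (a₀ : ℝ) (n : ℕ) : ℝ := 1 + a₀ / Real.log n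

/-- The number `M` of bandwidths, `M - 2 = max {j ∈ ℕ : h_0 (1 + a_n)^j < 1}`. -/
def gridSize (d : ℕ) (a₀ : ℝ) (n : ℕ) : ℕ :=
  sSup {j : ℕ | smallestBandwidth d n * gridStep a₀ n ^ j < 1} + 2

/-- The bandwidths `h_j = (1 + a_n)^j h_0` for `j ≤ M - 2`, and `h_{M-1} = 1`. -/
def gridBandwidth (d : ℕ) (a₀ : ℝ) (n : ℕ) (j : Fin (gridSize d a₀ n)) : ℝ :=
  if (j : ℕ) + 1 = gridSize d a₀ n then 1 else gridStep a₀ n ^ (j : ℕ) * smallestBandwidth d n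

/-- `m = ⌊n (1 - 1 / log n)⌋`. -/
def trainSize (n : ℕ) : ℕ := ⌊(n : ℝ) * (1 - (Real.log n)⁻¹)⌋₊

/-- `ℓ = n - m`; note that `m ≤ n`. -/
def validSize (n : ℕ) : ℕ := n - trainSize n

/-- `T` is an averaged aggregate of the kernel estimators with kernels `K j` and bandwidths in the
grid. -/
def IsKernelAggregate {d n N : ℕ} (kind : Kind) (a₀ : ℝ) (K : Fin N → Space d → ℝ)
    (𝒮 : Finset (Split n (trainSize n) (validSize n)))
    (T : (Fin n → Space d) → Space d → ℝ) : Prop :=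
  IsAveragedAggregate kind 𝒮
    (fun (j : Fin N × Fin (gridSize d a₀ n)) => kernelEstimator (K j.1) (gridBandwidth d a₀ n j.2))
    T

end DensityAggregation

end

/-! Two estimates are chained: aggregation costs little over the best initial estimator, and the
grid contains a bandwidth nearly as good as any other.

Aggregation. Freeze the training sample and let D be the squared norm, on the span of the initial
estimators, of the linear functional "validation mean minus expectation" (`deviation`). Both
aggregates satisfy a first order condition towards every initial estimator f, so expanding ‖f - p‖²
around the aggregate leaves a term ‖f - aggregate‖² which absorbs the noise up to D
(`loss_le_of_first_order`). The oracle loss therefore keeps the factor one. In an orthonormal basis,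
E D is at most L times the number of functions over ℓ (`lintegral_deviation_le`). Convexity of the
square makes averaging over splits free. With NM functions, M = O((log n)²) and ℓ ≥ n / log n, the
cost is of order N (log n)³ / n.

Grid. By Plancherel, the risk with bandwidth h and m observations is an integral over frequencies,
equal up to L / m to `bias` plus ‖K‖² / (m h^d). As the transform of K decreases along rays, the
bias is monotone in h. Rounding h down to the grid, and passing from n to m observations, thus
leaves the bias under control and inflates the variance by (1 + a_n)^d n / m = 1 + O(1 / log n).
Outside [h_0, 1) bandwidth one serves: for h ≥ 1 its bias is no larger and its variance is O(1/n);
for h < h_0 the risk at h already exceeds L, the ceiling of every bias. -/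

noncomputable section

namespace DensityAggregation

/-! ### The Fourier transform on `L_2` -/

section Fourier

/-- On `L_1 ∩ L_2` the Fourier transform of `L_2` is the Fourier integral. -/
theorem fourier_toLp_ae_eq {V : Type*} [NormedAddCommGroup V] [InnerProductSpace ℝ V]
    [FiniteDimensional ℝ V] [MeasurableSpace V] [BorelSpace V] {f : V → ℂ}
    (hf : Integrable f) (hf2 : MemLp f 2) :
    (𝓕 (hf2.toLp f) : Lp ℂ 2 (volume : Measure V)) =ᵐ[volume] 𝓕 f := by
  have hcont : Continuous (𝓕 f) :=
    VectorFourier.fourierIntegral_continuous Real.continuous_fourierChar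
      (innerSL ℝ).continuous₂ hf
  have hG : LocallyIntegrable (𝓕 (hf2.toLp f) : Lp ℂ 2 (volume : Measure V)) volume :=
    (Lp.memLp _).locallyIntegrable (by norm_num)
  rw [← sub_ae_eq_zero]
  refine ae_eq_zero_of_integral_contDiff_smul_eq_zero (hG.sub hcont.locallyIntegrable) ?_
  intro g g_smooth g_cpt
  have hg₁ : HasCompactSupport (Complex.ofRealCLM ∘ g) := g_cpt.comp_left rfl
  have hg₂ : ContDiff ℝ (⊤ : ℕ∞) (Complex.ofRealCLM ∘ g) :=
    Complex.ofRealCLM.contDiff.comp g_smooth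
  set s := hg₁.toSchwartzMap hg₂ with hs
  have hsx : ∀ x, s x = (g x : ℂ) := fun x => rfl
  -- Both transforms pair with a test function `s` to the integral of `𝓕 s • f`: the one on `L_2`
  -- through tempered distributions, the integral one by Fubini.
  have e1 : ∫ x, s x • (𝓕 (hf2.toLp f) : Lp ℂ 2 (volume : Measure V)) x = ∫ x, 𝓕 s x • f x := by
    rw [← Lp.toTemperedDistribution_apply, ← Lp.fourier_toTemperedDistribution_eq,
      TemperedDistribution.fourier_apply, Lp.toTemperedDistribution_apply]
    apply integral_congr_ae
    filter_upwards [hf2.coeFn_toLp] with x hx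
    rw [hx]
  have e2 : ∫ x, s x • 𝓕 f x = ∫ x, 𝓕 s x • f x := by
    have := VectorFourier.integral_fourierIntegral_smul_eq_flip (L := innerₗ V) (f := f)
      (g := (s : V → ℂ)) (μ := volume) (ν := volume) Real.continuous_fourierChar
      continuous_inner hf s.integrable
    rw [flip_innerₗ] at this
    simp only [SchwartzMap.fourier_coe, smul_eq_mul] at this ⊢
    simp only [mul_comm (s _), mul_comm (𝓕 (⇑s) _)]
    exact this
  have i1 : Integrable fun x => g x • (𝓕 (hf2.toLp f) : Lp ℂ 2 (volume : Measure V)) x :=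
    hG.integrable_smul_left_of_hasCompactSupport g_smooth.continuous g_cpt
  have i2 : Integrable fun x => g x • 𝓕 f x :=
    hcont.locallyIntegrable.integrable_smul_left_of_hasCompactSupport g_smooth.continuous g_cpt
  have : ∀ x, g x • ((𝓕 (hf2.toLp f) : Lp ℂ 2 (volume : Measure V)) - 𝓕 f) x
      = g x • (𝓕 (hf2.toLp f) : Lp ℂ 2 (volume : Measure V)) x - g x • 𝓕 f x := fun x => by
    simp [mul_sub]
  simp_rw [this]
  rw [integral_sub i1 i2, sub_eq_zero]
  simpa [hsx] using e1.trans e2.symm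

end Fourier

/-! ### Reflected dilations -/

section Dilation

variable {d : ℕ}

/-- The map `x ↦ (z - x) / h`. -/
def dilation (h : ℝ) (z x : Space d) : Space d := h⁻¹ • (z - x)

theorem measurable_dilation (h : ℝ) (z : Space d) : Measurable (dilation h z) := by
  unfold dilation; fun_prop

theorem map_dilation {h : ℝ} (hh : 0 < h) (z : Space d) :
    Measure.map (dilation h z) volume = ENNReal.ofReal (h ^ d) • (volume : Measure (Space d)) := by
  have h1 : Measure.map (fun x : Space d => z - x) volume = volume :=
    (Measure.measurePreserving_sub_left volume z).map_eq
  have h2 : dilation h z = (fun x : Space d => h⁻¹ • x) ∘ fun x => z - x := rfl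
  rw [h2, ← Measure.map_map (by fun_prop) (by fun_prop), h1,
    Measure.map_addHaar_smul _ (inv_ne_zero hh.ne')]
  congr 2
  rw [finrank_euclideanSpace_fin, inv_pow, inv_inv, abs_of_pos (by positivity)]

theorem quasiMeasurePreserving_dilation {h : ℝ} (hh : 0 < h) (z : Space d) :
    Measure.QuasiMeasurePreserving (dilation h z) volume volume :=
  ⟨measurable_dilation h z, by
    rw [map_dilation hh]; exact Measure.smul_absolutelyContinuous⟩

theorem measurableEmbedding_dilation {h : ℝ} (hh : 0 < h) (z : Space d) :
    MeasurableEmbedding (dilation h z) := by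
  have h2 : dilation h z = (fun x : Space d => h⁻¹ • x) ∘ fun x => z - x := rfl
  rw [h2]
  exact (measurableEmbedding_const_smul₀ (inv_ne_zero hh.ne')).comp
    (MeasurableEquiv.subLeft z).measurableEmbedding

theorem integral_comp_dilation {F : Type*} [NormedAddCommGroup F] [NormedSpace ℝ F]
    {h : ℝ} (hh : 0 < h) (z : Space d) (f : Space d → F) :
    ∫ x, f (dilation h z x) = h ^ d • ∫ x, f x := by
  rw [← (measurableEmbedding_dilation hh z).integral_map, map_dilation hh,
    integral_smul_measure, ENNReal.toReal_ofReal (by positivity)]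

theorem lintegral_comp_dilation {h : ℝ} (hh : 0 < h) (z : Space d) (f : Space d → ℝ≥0∞) :
    ∫⁻ x, f (dilation h z x) = ENNReal.ofReal (h ^ d) * ∫⁻ x, f x := by
  rw [← (measurableEmbedding_dilation hh z).lintegral_map, map_dilation hh,
    lintegral_smul_measure, smul_eq_mul]

theorem integrable_comp_dilation {F : Type*} [NormedAddCommGroup F]
    {h : ℝ} (hh : 0 < h) (z : Space d) {f : Space d → F} (hf : Integrable f) :
    Integrable fun x => f (dilation h z x) := by
  have := (measurableEmbedding_dilation hh z).integrable_map_iff (g := f) (μ := volume)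
  rw [map_dilation hh] at this
  exact this.1 (hf.smul_measure ENNReal.ofReal_ne_top)

theorem memLp_comp_dilation {F : Type*} [NormedAddCommGroup F]
    {h : ℝ} (hh : 0 < h) (z : Space d) {f : Space d → F} (hf : MemLp f 2) :
    MemLp (fun x => f (dilation h z x)) 2 := by
  have := (measurableEmbedding_dilation hh z).memLp_map_measure_iff (g := f) (μ := volume) (p := 2)
  rw [map_dilation hh] at this
  exact this.1 (hf.smul_measure ENNReal.ofReal_ne_top)

theorem eLpNorm_comp_dilation {F : Type*} [NormedAddCommGroup F]
    {h : ℝ} (hh : 0 < h) (z : Space d) (f : Space d → F) :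
    eLpNorm (fun x => f (dilation h z x)) 2 volume
      = ENNReal.ofReal (h ^ d) ^ (1 / 2 : ℝ) * eLpNorm f 2 volume := by
  have := (measurableEmbedding_dilation hh z).eLpNorm_map_measure (g := f) (μ := volume) (p := 2)
  rw [map_dilation hh, eLpNorm_smul_measure_of_ne_top (by norm_num)] at this
  simpa [Function.comp_def] using this.symm

end Dilation

/-! ### Fourier transform of a reflected dilation -/

section FourierDilation

variable {d : ℕ}

/-- The unimodular number `exp(-2π i ⟪z, ξ⟫)`. -/
def phase (z ξ : Space d) : ℂ := (Real.fourierChar (-(inner ℝ z ξ)) : Circle)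

theorem norm_phase (z ξ : Space d) : ‖phase z ξ‖ = 1 := Circle.norm_coe _

theorem continuous_phase {X : Type*} [TopologicalSpace X] {f g : X → Space d}
    (hf : Continuous f) (hg : Continuous g) : Continuous fun t => phase (f t) (g t) := by
  unfold phase
  exact Continuous.comp continuous_subtype_val (Real.continuous_fourierChar.comp (by fun_prop))

/-- The Fourier integral of a reflected dilation. -/
theorem fourier_comp_dilation {h : ℝ} (hh : 0 < h) (z : Space d) (f : Space d → ℂ) (ξ : Space d) :
    𝓕 (fun x => f (dilation h z x)) ξ
      = (h : ℂ) ^ d * (phase z ξ * 𝓕 f (dilation h⁻¹ 0 ξ)) := by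
  -- With u = (z - x) / h one has x = z - h u, so the character splits; `dilation h⁻¹ 0 ξ` is -hξ.
  have h1 : ∀ x, Real.fourierChar (-(inner ℝ x ξ)) • f (dilation h z x)
      = (fun u => phase z ξ *
          (Real.fourierChar (-(inner ℝ u (dilation h⁻¹ 0 ξ))) • f u)) (dilation h z x) := by
    intro x
    simp only [phase, Circle.smul_def, smul_eq_mul, ← mul_assoc]
    rw [← Circle.coe_mul, ← AddChar.map_add_eq_mul]
    congr 4
    simp only [dilation, inner_smul_left, inner_smul_right, inner_sub_left, inner_sub_right,
      inner_zero_right]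
    simp
    field_simp
    ring
  rw [Real.fourier_eq]
  simp_rw [h1]
  rw [integral_comp_dilation hh z (fun u => phase z ξ *
    (Real.fourierChar (-(inner ℝ u (dilation h⁻¹ 0 ξ))) • f u)), integral_const_mul, Real.fourier_eq]
  simp

theorem enorm_toLp {f : Space d → ℂ} (hf : MemLp f 2) : ‖hf.toLp f‖ₑ = eLpNorm f 2 volume := by
  rw [← ofReal_norm, Lp.norm_toLp, ENNReal.ofReal_toReal hf.eLpNorm_ne_top]

/-- The Fourier transform in `L_2` of a reflected dilation. -/
theorem fourier_toLp_comp_dilation {h : ℝ} (hh : 0 < h) (z : Space d) {f : Space d → ℂ}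
    (hf : MemLp f 2) :
    (𝓕 ((memLp_comp_dilation hh z hf).toLp _) : Lp ℂ 2 (volume : Measure (Space d)))
      =ᵐ[volume] fun ξ => (h : ℂ) ^ d * (phase z ξ *
        (𝓕 (hf.toLp f) : Lp ℂ 2 (volume : Measure (Space d))) (dilation h⁻¹ 0 ξ)) := by
  set C : ℝ≥0∞ := ENNReal.ofReal (h ^ d) ^ (1 / 2 : ℝ) with hC
  set B : (Space d → ℂ) → Space d → ℂ := fun g ξ =>
    (h : ℂ) ^ d * (phase z ξ * g (dilation h⁻¹ 0 ξ)) with hB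
  -- On the frequency side h^d · h^(-d/2) = h^(d/2), the same factor `C` as for the dilation in
  -- space.
  have hBnorm : ∀ g : Space d → ℂ, eLpNorm (B g) 2 volume = C * eLpNorm g 2 volume := by
    intro g
    have : eLpNorm (B g) 2 volume
        = eLpNorm (fun ξ => ((h : ℝ) ^ d) • g (dilation h⁻¹ 0 ξ)) 2 volume := by
      apply eLpNorm_congr_norm_ae
      filter_upwards with ξ
      simp [hB, norm_phase]
    rw [this]
    have h2 := eLpNorm_const_smul (h ^ d : ℝ) (fun ξ => g (dilation h⁻¹ 0 ξ)) 2
      (volume : Measure (Space d))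
    have h3 : (fun ξ => ((h : ℝ) ^ d) • g (dilation h⁻¹ 0 ξ))
      = (h ^ d : ℝ) • (fun ξ => g (dilation h⁻¹ 0 ξ)) := rfl
    rw [h3, h2, eLpNorm_comp_dilation (inv_pos.2 hh), ← mul_assoc]
    congr 1
    rw [hC, Real.enorm_of_nonneg (by positivity), inv_pow, ENNReal.ofReal_inv_of_pos (by positivity),
      ENNReal.inv_rpow, ← ENNReal.rpow_neg]
    have hne : ENNReal.ofReal (h ^ d) ≠ 0 := by
      rw [Ne, ENNReal.ofReal_eq_zero, not_le]; positivity
    nth_rewrite 1 [← ENNReal.rpow_one (ENNReal.ofReal (h ^ d))]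
    rw [← ENNReal.rpow_add _ _ hne ENNReal.ofReal_ne_top]
    norm_num
  have hBmeas : ∀ g : Space d → ℂ, AEStronglyMeasurable g volume →
      AEStronglyMeasurable (B g) volume := by
    intro g hg
    refine AEStronglyMeasurable.const_mul (AEStronglyMeasurable.mul ?_ ?_) _
    · exact (continuous_phase continuous_const continuous_id).aestronglyMeasurable
    · exact hg.comp_quasiMeasurePreserving (quasiMeasurePreserving_dilation (inv_pos.2 hh) 0)
  set F := (𝓕 (hf.toLp f) : Lp ℂ 2 (volume : Measure (Space d))) with hF
  set G := (𝓕 ((memLp_comp_dilation hh z hf).toLp _) : Lp ℂ 2 (volume : Measure (Space d))) with hG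
  -- The two sides agree at a Schwartz function and both scale the norm by `C`, hence the factor 2C;
  -- density of Schwartz functions then concludes.
  have key : ∀ s : SchwartzMap (Space d) ℂ,
      eLpNorm (⇑G - B F) 2 volume ≤ 2 * C * eLpNorm (f - ⇑s) 2 volume := by
    intro s
    have hs : MemLp s 2 (volume : Measure (Space d)) := s.memLp 2 volume
    have hs1 : (𝓕 ((memLp_comp_dilation hh z hs).toLp _) : Lp ℂ 2 (volume : Measure (Space d)))
        =ᵐ[volume] B (𝓕 (hs.toLp s) : Lp ℂ 2 (volume : Measure (Space d))) := by
      have a1 := fourier_toLp_ae_eq (integrable_comp_dilation hh z s.integrable)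
        (memLp_comp_dilation hh z hs)
      have a2 := (quasiMeasurePreserving_dilation (inv_pos.2 hh) (0 : Space d)).ae_eq_comp
        (fourier_toLp_ae_eq s.integrable hs)
      filter_upwards [a1, a2] with ξ h1 h2
      simp only [Function.comp_apply] at h2
      simp only [hB]
      rw [h1, h2, fourier_comp_dilation hh]
    set F' := (𝓕 (hs.toLp s) : Lp ℂ 2 (volume : Measure (Space d))) with hF'
    set G' := (𝓕 ((memLp_comp_dilation hh z hs).toLp _) : Lp ℂ 2 (volume : Measure (Space d)))
      with hG'
    have e1 : eLpNorm (⇑G - ⇑G') 2 volume = C * eLpNorm (f - ⇑s) 2 volume := by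
      rw [← eLpNorm_congr_ae (Lp.coeFn_sub G G'), ← Lp.enorm_def, hG, hG']
      rw [sub_eq_add_neg, ← neg_one_smul ℂ, ← FourierTransform.fourier_smul,
        ← FourierTransform.fourier_add, neg_one_smul, ← sub_eq_add_neg, ← MemLp.toLp_sub]
      rw [← ofReal_norm, Lp.norm_fourier_eq, ofReal_norm, enorm_toLp]
      exact eLpNorm_comp_dilation hh z (f - ⇑s)
    have e2 : eLpNorm (B F' - B F) 2 volume = C * eLpNorm (f - ⇑s) 2 volume := by
      have : B F' - B F = B (⇑F' - ⇑F) := by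
        funext ξ; simp [hB, mul_sub]
      rw [this, hBnorm, ← eLpNorm_congr_ae (Lp.coeFn_sub F' F), ← Lp.enorm_def, hF, hF']
      rw [sub_eq_add_neg, ← neg_one_smul ℂ, ← FourierTransform.fourier_smul,
        ← FourierTransform.fourier_add, neg_one_smul, ← sub_eq_add_neg, ← MemLp.toLp_sub]
      rw [← ofReal_norm, Lp.norm_fourier_eq, ofReal_norm, enorm_toLp, eLpNorm_sub_comm]
    have e3 : ⇑G - B F =ᵐ[volume] (⇑G - ⇑G') + (B F' - B F) := by
      filter_upwards [hs1] with ξ h1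
      simp only [Pi.sub_apply, Pi.add_apply, h1]; ring
    rw [eLpNorm_congr_ae e3]
    refine (eLpNorm_add_le ?_ ?_ (by norm_num)).trans ?_
    · exact (Lp.aestronglyMeasurable _).sub (Lp.aestronglyMeasurable _)
    · exact (hBmeas _ (Lp.aestronglyMeasurable _)).sub (hBmeas _ (Lp.aestronglyMeasurable _))
    · rw [e1, e2, two_mul, add_mul]
  have hzero : eLpNorm (⇑G - B F) 2 volume = 0 := by
    have hdense := SchwartzMap.denseRange_toLpCLM (F := ℂ) (E := Space d) (p := 2)
      (μ := volume) (by norm_num)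
    refine le_antisymm (ENNReal.le_of_forall_pos_le_add fun ε hε _ => ?_) zero_le
    rw [zero_add]
    have h2C : 2 * C + 1 ≠ ∞ := by finiteness
    have hpos : 0 < (ε : ℝ≥0∞) / (2 * C + 1) :=
      ENNReal.div_pos (by simpa using hε.ne') h2C
    obtain ⟨_, ⟨s, rfl⟩, hs⟩ := EMetric.mem_closure_iff.1 (hdense (hf.toLp f)) _ hpos
    have hs' : eLpNorm (f - ⇑s) 2 volume < (ε : ℝ≥0∞) / (2 * C + 1) := by
      have : eLpNorm (f - ⇑s) 2 volume = edist (hf.toLp f) (SchwartzMap.toLpCLM ℂ ℂ 2 volume s) := by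
        rw [Lp.edist_def]
        apply eLpNorm_congr_ae
        filter_upwards [hf.coeFn_toLp, s.coeFn_toLp 2 volume] with x h1 h2
        simp only [Pi.sub_apply, h1, SchwartzMap.toLpCLM_apply, h2]
      rwa [this]
    calc _ ≤ 2 * C * eLpNorm (f - ⇑s) 2 volume := key s
      _ ≤ (2 * C + 1) * ((ε : ℝ≥0∞) / (2 * C + 1)) := by gcongr; exact le_self_add
      _ ≤ ε := ENNReal.mul_div_le
  rw [eLpNorm_eq_zero_iff ((Lp.aestronglyMeasurable _).sub
    (hBmeas _ (Lp.aestronglyMeasurable _))) (by norm_num)] at hzero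
  exact (sub_ae_eq_zero _ _).1 hzero

end FourierDilation

/-! ### Consequences of the bound on the density -/

section BoundedDensity

variable {d : ℕ} {L : ℝ} {p : Space d → ℝ}

/-- The law with density `p`. -/
def densityMeasure (p : Space d → ℝ) : Measure (Space d) :=
  volume.withDensity fun x => ENNReal.ofReal (p x)

theorem sampleLaw_eq (n : ℕ) (p : Space d → ℝ) :
    sampleLaw n p = Measure.pi fun _ : Fin n => densityMeasure p := rfl

theorem IsBoundedDensity.isProbabilityMeasure (hp : IsBoundedDensity d L p) :
    IsProbabilityMeasure (densityMeasure p) := by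
  constructor
  rw [densityMeasure, withDensity_apply _ MeasurableSet.univ, Measure.restrict_univ,
    ← ofReal_integral_eq_lintegral_ofReal hp.integrable (Filter.Eventually.of_forall hp.nonneg),
    hp.integral_eq_one, ENNReal.ofReal_one]

theorem IsBoundedDensity.ae_le (hp : IsBoundedDensity d L p) (hL : 0 ≤ L) :
    ∀ᵐ x, p x ≤ L := by
  filter_upwards [ae_le_eLpNormEssSup (f := p) (μ := volume)] with x hx
  have h := hx.trans (by simpa [eLpNorm_exponent_top] using hp.bound)
  rw [Real.enorm_of_nonneg (hp.nonneg x)] at h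
  exact (ENNReal.ofReal_le_ofReal_iff hL).1 h

theorem densityMeasure_absolutelyContinuous (p : Space d → ℝ) :
    densityMeasure p ≪ volume := withDensity_absolutelyContinuous _ _

/-- This domination carries square integrability from Lebesgue measure to the law of an observation.
-/
theorem IsBoundedDensity.densityMeasure_le (hp : IsBoundedDensity d L p) (hL : 0 ≤ L) :
    densityMeasure p ≤ ENNReal.ofReal L • (volume : Measure (Space d)) := by
  rw [← withDensity_const]
  refine withDensity_mono ?_
  filter_upwards [hp.ae_le hL] with x hx
  exact ENNReal.ofReal_le_ofReal hx

theorem IsBoundedDensity.memLp (hp : IsBoundedDensity d L p) (hL : 0 ≤ L) : MemLp p 2 := by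
  rw [memLp_two_iff_integrable_sq hp.integrable.aestronglyMeasurable]
  refine (hp.integrable.const_mul L).mono' (hp.integrable.aestronglyMeasurable.pow 2) ?_
  filter_upwards [hp.ae_le hL] with x hx
  rw [Real.norm_of_nonneg (sq_nonneg _), sq]
  exact mul_le_mul_of_nonneg_right hx (hp.nonneg x)

theorem IsBoundedDensity.integral_sq_le (hp : IsBoundedDensity d L p) (hL : 0 ≤ L) :
    ∫ x, p x ^ 2 ≤ L := by
  calc ∫ x, p x ^ 2 ≤ ∫ x, L * p x := by
        refine integral_mono_ae (hp.memLp hL).integrable_sq (hp.integrable.const_mul L) ?_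
        filter_upwards [hp.ae_le hL] with x hx
        rw [sq]
        exact mul_le_mul_of_nonneg_right hx (hp.nonneg x)
    _ = L := by rw [integral_const_mul, hp.integral_eq_one, mul_one]

theorem IsBoundedDensity.integral_densityMeasure (hp : IsBoundedDensity d L p)
    {F : Type*} [NormedAddCommGroup F] [NormedSpace ℝ F] (g : Space d → F) :
    ∫ x, g x ∂(densityMeasure p) = ∫ x, p x • g x := by
  rw [densityMeasure, integral_withDensity_eq_integral_toReal_smul₀
    hp.integrable.aestronglyMeasurable.aemeasurable.ennreal_ofReal (by simp)]
  simp only [ENNReal.toReal_ofReal (hp.nonneg _)]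

theorem IsBoundedDensity.memLp_densityMeasure (hp : IsBoundedDensity d L p) (hL : 0 ≤ L)
    {F : Type*} [NormedAddCommGroup F] {g : Space d → F} (hg : MemLp g 2) :
    MemLp g 2 (densityMeasure p) :=
  (hg.smul_measure ENNReal.ofReal_ne_top).mono_measure (hp.densityMeasure_le hL)

end BoundedDensity

/-! ### Mean of an i.i.d. sample -/

section SampleMean

variable {Ω : Type*} [MeasurableSpace Ω] {μ : Measure Ω} [IsProbabilityMeasure μ]

/-- Bias-variance decomposition for the mean of an i.i.d. sample. -/
theorem integral_sampleMean_sub_sq {n : ℕ} (hn : n ≠ 0) {g : Ω → ℝ} (hg : MemLp g 2 μ) (b : ℝ) :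
    Integrable (fun X : Fin n → Ω => ((1 / (n : ℝ)) * ∑ i, g (X i) - b) ^ 2)
      (Measure.pi fun _ => μ) ∧
    ∫ X : Fin n → Ω, ((1 / (n : ℝ)) * ∑ i, g (X i) - b) ^ 2 ∂(Measure.pi fun _ => μ)
      = (∫ x, g x ^ 2 ∂μ - (∫ x, g x ∂μ) ^ 2) / n + (∫ x, g x ∂μ - b) ^ 2 := by
  set P : Measure (Fin n → Ω) := Measure.pi fun _ => μ with hP
  have hn' : (n : ℝ) ≠ 0 := Nat.cast_ne_zero.2 hn
  have hgi : ∀ i, MemLp (fun X : Fin n → Ω => g (X i)) 2 P := fun i =>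
    hg.comp_measurePreserving (measurePreserving_eval _ i)
  have hint : ∀ i, ∫ X, g (X i) ∂P = ∫ x, g x ∂μ := fun i =>
    integral_comp_eval (μ := fun _ : Fin n => μ) hg.aestronglyMeasurable
  have hS : MemLp (fun X : Fin n → Ω => (1 / (n : ℝ)) * ∑ i, g (X i)) 2 P :=
    (memLp_finsetSum _ fun i _ => hgi i).const_mul _
  have hSm : ∫ X, (1 / (n : ℝ)) * ∑ i, g (X i) ∂P = ∫ x, g x ∂μ := by
    rw [integral_const_mul, integral_finsetSum _ fun i _ => (hgi i).integrable (by norm_num)]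
    simp [hint]; field_simp
  have hSv : ProbabilityTheory.variance (fun X : Fin n → Ω => (1 / (n : ℝ)) * ∑ i, g (X i)) P
      = (∫ x, g x ^ 2 ∂μ - (∫ x, g x ∂μ) ^ 2) / n := by
    have h1 := ProbabilityTheory.variance_sum_pi (μ := fun _ : Fin n => μ) (X := fun _ => g)
      fun _ => hg
    rw [ProbabilityTheory.variance_const_mul]
    have h2 : (fun X : Fin n → Ω => ∑ i, g (X i)) = ∑ i, fun X : Fin n → Ω => g (X i) := by
      funext X; simp
    rw [h2, h1, ProbabilityTheory.variance_eq_sub hg]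
    simp
    field_simp
  refine ⟨(hS.sub (memLp_const b)).integrable_sq, ?_⟩
  have h3 := ProbabilityTheory.variance_eq_sub (hS.sub (memLp_const b))
  have h4 : ProbabilityTheory.variance
      ((fun X : Fin n → Ω => (1 / (n : ℝ)) * ∑ i, g (X i)) - fun _ => b) P
      = (∫ x, g x ^ 2 ∂μ - (∫ x, g x ∂μ) ^ 2) / n := by
    rw [← hSv]
    exact ProbabilityTheory.variance_sub_const hS.aestronglyMeasurable b
  rw [h4] at h3
  have h5 : ∫ X, ((fun X : Fin n → Ω => (1 / (n : ℝ)) * ∑ i, g (X i)) - fun _ => b : (Fin n → Ω) → ℝ) X ∂P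
      = ∫ x, g x ∂μ - b := by
    simp only [Pi.sub_apply]
    rw [integral_sub (hS.integrable (by norm_num)) (integrable_const b), hSm]
    simp
  rw [h5] at h3
  simp only [Pi.pow_apply, Pi.sub_apply] at h3
  linarith

end SampleMean

/-! ### Loss of a kernel estimator in the frequency domain -/

section Loss

variable {d : ℕ}

theorem memLp_ofReal {f : Space d → ℝ} (hf : MemLp f 2) : MemLp (fun x => (f x : ℂ)) 2 volume := hf.ofReal

/-- Plancherel, in the extended form in which the risk is written. -/
theorem lintegral_sq_eq_fourier {f : Space d → ℝ} (hf : MemLp f 2) :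
    ∫⁻ x, ENNReal.ofReal (f x ^ 2)
      = ∫⁻ ξ, ‖(𝓕 ((memLp_ofReal hf).toLp (fun x => (f x : ℂ))) :
          Lp ℂ 2 (volume : Measure (Space d))) ξ‖ₑ ^ 2 := by
  have h2 : ∀ g : Space d → ℂ, eLpNorm g 2 volume ^ 2 = ∫⁻ x, ‖g x‖ₑ ^ 2 := by
    intro g
    have := eLpNorm_nnreal_pow_eq_lintegral (p := 2) (f := g) (μ := volume) (by norm_num)
    simpa using this
  have h1 : ∫⁻ x, ENNReal.ofReal (f x ^ 2) = eLpNorm (fun x => (f x : ℂ)) 2 volume ^ 2 := by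
    rw [h2]
    congr 1 with x
    rw [← ofReal_norm, Complex.norm_real, ← ENNReal.ofReal_pow (norm_nonneg _), Real.norm_eq_abs,
      sq_abs]
  rw [h1, ← h2, ← enorm_toLp (memLp_ofReal hf), ← Lp.enorm_def, ← ofReal_norm, ← ofReal_norm,
    Lp.norm_fourier_eq]

/-- The empirical characteristic function. -/
def empiricalPhase {m : ℕ} (Z : Fin m → Space d) (ξ : Space d) : ℂ :=
  (1 / (m : ℂ)) * ∑ i, phase (Z i) ξ

theorem kernelEstimator_eq {m : ℕ} (K : Space d → ℝ) (h : ℝ) (Z : Fin m → Space d) :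
    kernelEstimator K h Z = fun x => (1 / ((m : ℝ) * h ^ d)) * ∑ i, K (dilation h (Z i) x) := rfl

theorem memLp_kernelEstimator {m : ℕ} {K : Space d → ℝ} (hK : MemLp K 2) {h : ℝ} (hh : 0 < h)
    (Z : Fin m → Space d) : MemLp (kernelEstimator K h Z) 2  := by
  have h1 : MemLp (fun x => ∑ i, K (dilation h (Z i) x)) 2 volume :=
    memLp_finsetSum Finset.univ fun i _ => memLp_comp_dilation hh (Z i) hK
  exact h1.const_mul (1 / ((m : ℝ) * h ^ d))

/-- For t = 2πhξ the point -t/(2π), at which the version is compared with `𝓕`, is -hξ = `dilation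
h⁻¹ 0 ξ`. The substitution preserves null sets. -/
theorem IsFourierVersion.ae_dilation {K Φ : Space d → ℝ} (hK : MemLp K 2)
    (hΦ : IsFourierVersion K Φ) {h : ℝ} (hh : 0 < h) :
    ∀ᵐ ξ, (𝓕 ((memLp_ofReal hK).toLp (fun x => (K x : ℂ))) : Lp ℂ 2 (volume : Measure (Space d)))
      (dilation h⁻¹ 0 ξ) = (Φ ((2 * Real.pi * h) • ξ) : ℂ) := by
  obtain ⟨hK', h1⟩ := hΦ
  have hc : 0 < (2 * Real.pi * h)⁻¹ := by have := Real.pi_pos; positivity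
  have hq := (quasiMeasurePreserving_dilation hc (0 : Space d)).ae_eq_comp h1
  have hq2 := (Measure.measurePreserving_neg (volume : Measure (Space d))).quasiMeasurePreserving.ae_eq_comp hq
  filter_upwards [hq2] with ξ hξ
  simp only [Function.comp_apply, dilation, inv_inv, zero_sub, neg_neg] at hξ
  rw [← hξ]
  congr 1
  simp only [dilation, inv_inv, zero_sub, smul_neg, smul_smul]
  rw [← neg_smul]
  congr 1
  have := Real.pi_pos
  field_simp

/-- The `L_2` loss of a kernel estimator in the frequency domain. -/
theorem lintegral_loss_kernelEstimator {m : ℕ} (hm : m ≠ 0) {K Φ p : Space d → ℝ}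
    (hK : MemLp K 2) (hΦ : IsFourierVersion K Φ) (hp : Integrable p) (hp2 : MemLp p 2)
    {h : ℝ} (hh : 0 < h) (Z : Fin m → Space d) :
    ∫⁻ x, ENNReal.ofReal ((kernelEstimator K h Z x - p x) ^ 2)
      = ∫⁻ ξ, ‖(Φ ((2 * Real.pi * h) • ξ) : ℂ) * empiricalPhase Z ξ
          - 𝓕 (fun x => (p x : ℂ)) ξ‖ₑ ^ 2 := by
  have hE := memLp_kernelEstimator hK hh Z
  have hEp : MemLp (fun x => kernelEstimator K h Z x - p x) 2 volume := hE.sub hp2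
  have hpc : Integrable (fun x => (p x : ℂ)) volume := hp.ofReal
  rw [lintegral_sq_eq_fourier hEp]
  apply lintegral_congr_ae
  have hD : ∀ i, MemLp (fun x => (K (dilation h (Z i) x) : ℂ)) 2 := fun i =>
    memLp_comp_dilation hh (Z i) (memLp_ofReal hK)
  set c : ℂ := ((1 / ((m : ℝ) * h ^ d) : ℝ) : ℂ) with hc
  have e1 : (memLp_ofReal hEp).toLp
        (fun x => ((kernelEstimator K h Z x - p x : ℝ) : ℂ))
      = c • ∑ i, (hD i).toLp _ - (memLp_ofReal hp2).toLp (fun x => (p x : ℂ)) := by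
    apply Lp.ext
    have hsum := Lp.coeFn_finsetSum (p := 2) Finset.univ (fun i => (hD i).toLp _)
    have hall : ∀ᵐ x, ∀ i, (hD i).toLp _ x = (K (dilation h (Z i) x) : ℂ) :=
      ae_all_iff.2 fun i => (hD i).coeFn_toLp
    filter_upwards [(memLp_ofReal hEp).coeFn_toLp, (memLp_ofReal hp2).coeFn_toLp, hsum,
      hall, Lp.coeFn_sub (c • ∑ i, (hD i).toLp _) ((memLp_ofReal hp2).toLp (fun x => (p x : ℂ))),
      Lp.coeFn_smul c (∑ i, (hD i).toLp _)] with x h1 h2 h3 h4 h5 h6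
    rw [h1, h5, Pi.sub_apply, h2, h6, Pi.smul_apply, h3, Finset.sum_apply]
    simp only [h4, kernelEstimator_eq, smul_eq_mul, hc]
    push_cast
    rfl
  have e2 : (𝓕 ((memLp_ofReal hEp).toLp
        (fun x => ((kernelEstimator K h Z x - p x : ℝ) : ℂ))) :
          Lp ℂ 2 (volume : Measure (Space d)))
      = c • ∑ i, 𝓕 ((hD i).toLp _) - 𝓕 ((memLp_ofReal hp2).toLp (fun x => (p x : ℂ))) := by
    rw [e1]
    change Lp.fourierTransformₗᵢ (Space d) ℂ _ = _
    rw [map_sub, map_smul, map_sum]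
    rfl
  have hsum := Lp.coeFn_finsetSum (p := 2) Finset.univ
    (fun i => (𝓕 ((hD i).toLp _) : Lp ℂ 2 (volume : Measure (Space d))))
  have hall := ae_all_iff.2 fun i => fourier_toLp_comp_dilation hh (Z i) (memLp_ofReal hK)
  filter_upwards [hsum, hall,
    Lp.coeFn_sub (c • ∑ i, (𝓕 ((hD i).toLp _) : Lp ℂ 2 (volume : Measure (Space d))))
      (𝓕 ((memLp_ofReal hp2).toLp (fun x => (p x : ℂ)))),
    Lp.coeFn_smul c (∑ i, (𝓕 ((hD i).toLp _) : Lp ℂ 2 (volume : Measure (Space d)))),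
    fourier_toLp_ae_eq hpc (memLp_ofReal hp2), hΦ.ae_dilation hK hh]
    with ξ h1 h2 h3 h4 h5 h6
  rw [e2, h3, Pi.sub_apply, h4, Pi.smul_apply, h1, Finset.sum_apply]
  simp only [h2, h6]
  rw [h5, ← Finset.mul_sum, ← Finset.sum_mul, smul_eq_mul, empiricalPhase, hc]
  -- The factor h^d of each transformed dilation cancels the normalization h^(-d) of the estimator.
  have hm' : (m : ℂ) ≠ 0 := Nat.cast_ne_zero.2 hm
  have hh' : (h : ℂ) ^ d ≠ 0 := pow_ne_zero _ (by exact_mod_cast hh.ne')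
  congr 3
  push_cast
  field_simp

end Loss

/-! ### Bias and variance of a kernel estimator -/

section KernelRisk

variable {d : ℕ} {L : ℝ} {p : Space d → ℝ}

/-- The characteristic function of a density. -/
def charFn (p : Space d → ℝ) (ξ : Space d) : ℂ := 𝓕 (fun x => (p x : ℂ)) ξ

theorem continuous_charFn (hp : Integrable p) : Continuous (charFn p) :=
  VectorFourier.fourierIntegral_continuous Real.continuous_fourierChar
    (innerSL ℝ).continuous₂ hp.ofReal

theorem integrable_phase {μ : Measure (Space d)} [IsFiniteMeasure μ] (ξ : Space d) :
    Integrable (fun z => phase z ξ) μ := by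
  refine (integrable_const (1 : ℝ)).mono' ?_ (Filter.Eventually.of_forall fun z => ?_)
  · exact (continuous_phase continuous_id continuous_const).aestronglyMeasurable
  · rw [norm_phase]

theorem IsBoundedDensity.charFn_eq (hp : IsBoundedDensity d L p) (ξ : Space d) :
    charFn p ξ = ∫ z, phase z ξ ∂(densityMeasure p) := by
  rw [hp.integral_densityMeasure, charFn, Real.fourier_eq]
  congr 1 with z
  simp only [phase, Circle.smul_def, smul_eq_mul, Complex.real_smul, mul_comm]

theorem IsBoundedDensity.norm_charFn_le (hp : IsBoundedDensity d L p) (ξ : Space d) :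
    ‖charFn p ξ‖ ≤ 1 := by
  have := hp.isProbabilityMeasure
  rw [hp.charFn_eq]
  refine (norm_integral_le_integral_norm _).trans ?_
  simp [norm_phase]

/-- Plancherel combined with ‖p‖² ≤ ‖p‖_∞ ∫ p. -/
theorem IsBoundedDensity.lintegral_sq_charFn_le (hp : IsBoundedDensity d L p) (hL : 0 ≤ L) :
    ∫⁻ ξ, ENNReal.ofReal (‖charFn p ξ‖ ^ 2) ≤ ENNReal.ofReal L := by
  have h1 := lintegral_sq_eq_fourier (hp.memLp hL)
  have hpc : Integrable (fun x => (p x : ℂ)) volume := hp.integrable.ofReal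
  have h2 : ∫⁻ ξ, ENNReal.ofReal (‖charFn p ξ‖ ^ 2) = ∫⁻ x, ENNReal.ofReal (p x ^ 2) := by
    rw [h1]
    apply lintegral_congr_ae
    filter_upwards [fourier_toLp_ae_eq hpc (memLp_ofReal (hp.memLp hL))] with ξ hξ
    rw [hξ, ENNReal.ofReal_pow (norm_nonneg _), ofReal_norm]
    rfl
  rw [h2, ← ofReal_integral_eq_lintegral_ofReal (hp.memLp hL).integrable_sq
    (Filter.Eventually.of_forall fun x => sq_nonneg _)]
  exact ENNReal.ofReal_le_ofReal (hp.integral_sq_le hL)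

/-- The mean squared error of the empirical characteristic function shrunk by `a`. -/
theorem IsBoundedDensity.lintegral_empiricalPhase (hp : IsBoundedDensity d L p) {m : ℕ}
    (hm : m ≠ 0) (a : ℝ) (ξ : Space d) :
    ∫⁻ Z : Fin m → Space d, ‖(a : ℂ) * empiricalPhase Z ξ - charFn p ξ‖ₑ ^ 2 ∂(sampleLaw m p)
      = ENNReal.ofReal ((1 - a) ^ 2 * ‖charFn p ξ‖ ^ 2 + a ^ 2 * (1 - ‖charFn p ξ‖ ^ 2) / m) := by
  have := hp.isProbabilityMeasure
  set μ := densityMeasure p with hμ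
  have hcont : Continuous fun z : Space d => phase z ξ :=
    continuous_phase continuous_id continuous_const
  have cre : Continuous fun z : Space d => (phase z ξ).re := Complex.continuous_re.comp hcont
  have cim : Continuous fun z : Space d => (phase z ξ).im := Complex.continuous_im.comp hcont
  have hre' : MemLp (fun z => (phase z ξ).re) 2 μ :=
    MemLp.of_bound cre.aestronglyMeasurable 1 (Filter.Eventually.of_forall fun z =>
      (Complex.abs_re_le_norm _).trans (norm_phase z ξ).le)
  have him' : MemLp (fun z => (phase z ξ).im) 2 μ :=
    MemLp.of_bound cim.aestronglyMeasurable 1 (Filter.Eventually.of_forall fun z =>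
      (Complex.abs_im_le_norm _).trans (norm_phase z ξ).le)
  have hre : MemLp (fun z => a * (phase z ξ).re) 2 μ := hre'.const_mul a
  have him : MemLp (fun z => a * (phase z ξ).im) 2 μ := him'.const_mul a
  obtain ⟨i1, e1⟩ := integral_sampleMean_sub_sq hm hre (charFn p ξ).re
  obtain ⟨i2, e2⟩ := integral_sampleMean_sub_sq hm him (charFn p ξ).im
  -- Real and imaginary parts are separately means of i.i.d. real variables; since the phase is
  -- unimodular, their second moments add up to a².
  have hpt : ∀ Z : Fin m → Space d, ‖(a : ℂ) * empiricalPhase Z ξ - charFn p ξ‖ₑ ^ 2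
      = ENNReal.ofReal (((1 / (m : ℝ)) * ∑ i, a * (phase (Z i) ξ).re - (charFn p ξ).re) ^ 2
        + ((1 / (m : ℝ)) * ∑ i, a * (phase (Z i) ξ).im - (charFn p ξ).im) ^ 2) := by
    intro Z
    rw [← ofReal_norm, ← ENNReal.ofReal_pow (norm_nonneg _), ← Complex.normSq_eq_norm_sq,
      Complex.normSq_apply]
    congr 1
    have hm1 : (1 / (m : ℂ)) = ((1 / (m : ℝ) : ℝ) : ℂ) := by push_cast; rfl
    simp only [empiricalPhase, Complex.sub_re, Complex.sub_im, hm1, Complex.re_ofReal_mul,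
      Complex.im_ofReal_mul, Complex.re_sum, Complex.im_sum, ← Finset.mul_sum]
    ring
  have hr : ∫ z, (phase z ξ).re ∂μ = (charFn p ξ).re := by
    rw [hp.charFn_eq]; exact integral_re (integrable_phase ξ)
  have hi : ∫ z, (phase z ξ).im ∂μ = (charFn p ξ).im := by
    rw [hp.charFn_eq]; exact integral_im (integrable_phase ξ)
  have hsq : ∫ z, (a * (phase z ξ).re) ^ 2 ∂μ + ∫ z, (a * (phase z ξ).im) ^ 2 ∂μ = a ^ 2 := by
    rw [← integral_add hre.integrable_sq him.integrable_sq]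
    have : ∀ z, (a * (phase z ξ).re) ^ 2 + (a * (phase z ξ).im) ^ 2 = a ^ 2 := by
      intro z
      have h1 : Complex.normSq (phase z ξ) = 1 := by
        rw [Complex.normSq_eq_norm_sq, norm_phase, one_pow]
      rw [Complex.normSq_apply] at h1
      linear_combination a ^ 2 * h1
    simp [this]
  simp_rw [hpt]
  have i12 : Integrable (fun Z : Fin m → Space d =>
      ((1 / (m : ℝ)) * ∑ i, a * (phase (Z i) ξ).re - (charFn p ξ).re) ^ 2
        + ((1 / (m : ℝ)) * ∑ i, a * (phase (Z i) ξ).im - (charFn p ξ).im) ^ 2)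
      (Measure.pi fun _ => μ) := i1.add i2
  rw [sampleLaw_eq, ← hμ, ← ofReal_integral_eq_lintegral_ofReal i12
    (Filter.Eventually.of_forall fun Z => by positivity)]
  rw [integral_add i1 i2, e1, e2, integral_const_mul, integral_const_mul, hr, hi,
    ← Complex.normSq_eq_norm_sq, Complex.normSq_apply]
  congr 1
  linear_combination (1 / (m : ℝ)) * hsq

/-- `Φ` is determined only up to a null set, so its measurability is inherited from the `L_2` class
it represents. -/
theorem IsFourierVersion.aemeasurable {K Φ : Space d → ℝ} (hK : MemLp K 2)
    (hΦ : IsFourierVersion K Φ) {h : ℝ} (hh : 0 < h) :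
    AEMeasurable (fun ξ => Φ ((2 * Real.pi * h) • ξ)) volume := by
  have h1 : AEMeasurable (fun ξ => (𝓕 ((memLp_ofReal hK).toLp (fun x => (K x : ℂ))) :
      Lp ℂ 2 (volume : Measure (Space d))) (dilation h⁻¹ 0 ξ)) volume :=
    ((Lp.aestronglyMeasurable _).comp_quasiMeasurePreserving
      (quasiMeasurePreserving_dilation (inv_pos.2 hh) 0)).aemeasurable
  refine (Complex.measurable_re.comp_aemeasurable h1).congr ?_
  filter_upwards [hΦ.ae_dilation hK hh] with ξ hξ
  simp [hξ]

/-- Plancherel and a change of scale; divided by the sample size, this is the leading variance term.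
-/
theorem IsFourierVersion.lintegral_sq {K Φ : Space d → ℝ} (hK : MemLp K 2)
    (hΦ : IsFourierVersion K Φ) {h : ℝ} (hh : 0 < h) :
    ∫⁻ ξ, ENNReal.ofReal (Φ ((2 * Real.pi * h) • ξ) ^ 2)
      = ENNReal.ofReal (l2Norm K ^ 2 / h ^ d) := by
  have h1 : ∫⁻ ξ, ENNReal.ofReal (Φ ((2 * Real.pi * h) • ξ) ^ 2)
      = ∫⁻ ξ, (fun η => ‖(𝓕 ((memLp_ofReal hK).toLp (fun x => (K x : ℂ))) :
      Lp ℂ 2 (volume : Measure (Space d))) η‖ₑ ^ 2) (dilation h⁻¹ 0 ξ) := by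
    apply lintegral_congr_ae
    filter_upwards [hΦ.ae_dilation hK hh] with ξ hξ
    rw [hξ, ← ofReal_norm, Complex.norm_real, ← ENNReal.ofReal_pow (norm_nonneg _),
      Real.norm_eq_abs, sq_abs]
  rw [h1, lintegral_comp_dilation (inv_pos.2 hh) 0 (fun η =>
    ‖(𝓕 ((memLp_ofReal hK).toLp (fun x => (K x : ℂ))) :
      Lp ℂ 2 (volume : Measure (Space d))) η‖ₑ ^ 2), ← lintegral_sq_eq_fourier hK]
  have h2 : ∫⁻ x, ENNReal.ofReal (K x ^ 2) = ENNReal.ofReal (l2Norm K ^ 2) := by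
    have := eLpNorm_nnreal_pow_eq_lintegral (p := 2) (f := K) (μ := volume) (by norm_num)
    rw [l2Norm, ENNReal.ofReal_pow ENNReal.toReal_nonneg, ENNReal.ofReal_toReal hK.eLpNorm_ne_top]
    have h3 : eLpNorm K 2 volume ^ 2 = ∫⁻ x, ‖K x‖ₑ ^ 2 := by simpa using this
    rw [h3]
    congr 1 with x
    rw [← ofReal_norm, ← ENNReal.ofReal_pow (norm_nonneg _), Real.norm_eq_abs, sq_abs]
  rw [h2, ← ENNReal.ofReal_mul (by positivity)]
  congr 1
  rw [inv_pow]
  field_simp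

/-- The integrated squared bias of a kernel estimator, in the frequency domain. -/
def bias (Φ p : Space d → ℝ) (h : ℝ) : ℝ≥0∞ :=
  ∫⁻ ξ, ENNReal.ofReal ((1 - Φ ((2 * Real.pi * h) • ξ)) ^ 2 * ‖charFn p ξ‖ ^ 2)

theorem aemeasurable_loss (hp : Integrable p) {m : ℕ}
    {K Φ : Space d → ℝ} (hK : MemLp K 2) (hΦ : IsFourierVersion K Φ) {h : ℝ} (hh : 0 < h)
    (P : Measure (Fin m → Space d)) :
    AEMeasurable (Function.uncurry fun (Z : Fin m → Space d) (ξ : Space d) =>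
      ‖(Φ ((2 * Real.pi * h) • ξ) : ℂ) * empiricalPhase Z ξ - charFn p ξ‖ₑ ^ 2)
      (P.prod volume) := by
  have h0 : AEMeasurable (fun q : (Fin m → Space d) × Space d => Φ ((2 * Real.pi * h) • q.2))
      (P.prod volume) :=
    (hΦ.aemeasurable hK hh).comp_quasiMeasurePreserving Measure.quasiMeasurePreserving_snd
  have h1 : AEMeasurable (fun q : (Fin m → Space d) × Space d =>
      (Φ ((2 * Real.pi * h) • q.2) : ℂ)) (P.prod volume) :=
    Complex.measurable_ofReal.comp_aemeasurable h0
  have h2 : Continuous fun q : (Fin m → Space d) × Space d => empiricalPhase q.1 q.2 := by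
    unfold empiricalPhase
    refine continuous_const.mul (continuous_finsetSum _ fun i _ => ?_)
    exact continuous_phase (by fun_prop) continuous_snd
  have h3 : Continuous fun q : (Fin m → Space d) × Space d => charFn p q.2 :=
    (continuous_charFn hp).comp continuous_snd
  have h4 : AEMeasurable (fun q : (Fin m → Space d) × Space d =>
      (Φ ((2 * Real.pi * h) • q.2) : ℂ) * empiricalPhase q.1 q.2 - charFn p q.2)
      (P.prod volume) :=
    (h1.mul h2.measurable.aemeasurable).sub h3.measurable.aemeasurable
  exact h4.enorm.pow_const 2

/-- Tonelli exchanges sample and frequency; at each frequency the estimator is the empirical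
characteristic function shrunk by the value of `Φ`. -/
theorem IsBoundedDensity.risk_kernelEstimator (hp : IsBoundedDensity d L p) (hL : 0 ≤ L) {m : ℕ}
    (hm : m ≠ 0) {K Φ : Space d → ℝ} (hK : MemLp K 2) (hΦ : IsFourierVersion K Φ)
    {h : ℝ} (hh : 0 < h) :
    risk (fun Z : Fin m → Space d => kernelEstimator K h Z) p
      = ∫⁻ ξ, ENNReal.ofReal ((1 - Φ ((2 * Real.pi * h) • ξ)) ^ 2 * ‖charFn p ξ‖ ^ 2
        + Φ ((2 * Real.pi * h) • ξ) ^ 2 * (1 - ‖charFn p ξ‖ ^ 2) / m) := by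
  have := hp.isProbabilityMeasure
  rw [risk]
  simp_rw [lintegral_loss_kernelEstimator hm hK hΦ hp.integrable (hp.memLp hL) hh]
  have hs : SFinite (sampleLaw m p) := by rw [sampleLaw_eq]; infer_instance
  have := lintegral_lintegral_swap
    (aemeasurable_loss hp.integrable hK hΦ hh (sampleLaw m p))
  refine this.trans ?_
  congr 1 with ξ
  exact hp.lintegral_empiricalPhase hm _ ξ

/-- The loss of a kernel estimator is a measurable function of the sample. -/
theorem IsBoundedDensity.aemeasurable_loss_kernelEstimator (hp : IsBoundedDensity d L p)
    (hL : 0 ≤ L) {m : ℕ} (hm : m ≠ 0) {K Φ : Space d → ℝ} (hK : MemLp K 2)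
    (hΦ : IsFourierVersion K Φ) {h : ℝ} (hh : 0 < h) :
    AEMeasurable (fun Z : Fin m → Space d =>
      ∫⁻ x, ENNReal.ofReal ((kernelEstimator K h Z x - p x) ^ 2)) (sampleLaw m p) := by
  simp_rw [lintegral_loss_kernelEstimator hm hK hΦ hp.integrable (hp.memLp hL) hh]
  exact (aemeasurable_loss hp.integrable hK hΦ hh (sampleLaw m p)).lintegral_prod_right'

variable {K Φ : Space d → ℝ}

/-- Discards the negative part -Φ² |charFn|² / m of the variance. -/
theorem IsBoundedDensity.risk_kernelEstimator_le (hp : IsBoundedDensity d L p) (hL : 0 ≤ L) {m : ℕ}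
    (hm : m ≠ 0) (hK : MemLp K 2) (hΦ : IsFourierVersion K Φ) {h : ℝ} (hh : 0 < h) :
    risk (fun Z : Fin m → Space d => kernelEstimator K h Z) p
      ≤ bias Φ p h + ENNReal.ofReal (l2Norm K ^ 2 / h ^ d / m) := by
  have hm0 : (0 : ℝ) < m := by positivity
  have h1 : ENNReal.ofReal (l2Norm K ^ 2 / h ^ d / m)
      = ∫⁻ ξ, ENNReal.ofReal (Φ ((2 * Real.pi * h) • ξ) ^ 2 / m) := by
    simp_rw [ENNReal.ofReal_div_of_pos hm0, div_eq_mul_inv _ (ENNReal.ofReal (m : ℝ))]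
    rw [lintegral_mul_const'' _ ((hΦ.aemeasurable hK hh).pow_const 2).ennreal_ofReal,
      hΦ.lintegral_sq hK hh]
  rw [hp.risk_kernelEstimator hL hm hK hΦ hh, h1, bias, ← lintegral_add_right' _
    (((hΦ.aemeasurable hK hh).pow_const 2).div_const _).ennreal_ofReal]
  refine lintegral_mono fun ξ => ?_
  rw [← ENNReal.ofReal_add (by positivity) (by positivity)]
  apply ENNReal.ofReal_le_ofReal
  gcongr
  have := mul_nonneg (sq_nonneg (Φ ((2 * Real.pi * h) • ξ))) (sq_nonneg ‖charFn p ξ‖)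
  linarith

/-- The converse bound: as Φ² ≤ 1, the discarded variance is at most |charFn|² / n, whose integral
is at most L / n. -/
theorem IsBoundedDensity.le_risk_kernelEstimator (hp : IsBoundedDensity d L p) (hL : 0 ≤ L) {n : ℕ}
    (hn : n ≠ 0) (hK : MemLp K 2) (hΦ : IsFourierVersion K Φ) (hΦ1 : ∀ t, 0 ≤ Φ t ∧ Φ t ≤ 1)
    {h : ℝ} (hh : 0 < h) :
    bias Φ p h + ENNReal.ofReal (l2Norm K ^ 2 / h ^ d / n)
      ≤ risk (fun Z : Fin n → Space d => kernelEstimator K h Z) p + ENNReal.ofReal (L / n) := by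
  have hn0 : (0 : ℝ) < n := by positivity
  have h1 : ENNReal.ofReal (l2Norm K ^ 2 / h ^ d / n)
      = ∫⁻ ξ, ENNReal.ofReal (Φ ((2 * Real.pi * h) • ξ) ^ 2 / n) := by
    simp_rw [ENNReal.ofReal_div_of_pos hn0, div_eq_mul_inv _ (ENNReal.ofReal (n : ℝ))]
    rw [lintegral_mul_const'' _ ((hΦ.aemeasurable hK hh).pow_const 2).ennreal_ofReal,
      hΦ.lintegral_sq hK hh]
  have hmeas : Measurable fun ξ => ENNReal.ofReal (‖charFn p ξ‖ ^ 2 / n) :=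
    (((continuous_charFn hp.integrable).norm.pow 2).div_const _).measurable.ennreal_ofReal
  have h2 : ∫⁻ ξ, ENNReal.ofReal (‖charFn p ξ‖ ^ 2 / n) ≤ ENNReal.ofReal (L / n) := by
    simp_rw [ENNReal.ofReal_div_of_pos hn0, div_eq_mul_inv _ (ENNReal.ofReal (n : ℝ))]
    have hm2 : Measurable fun ξ => ENNReal.ofReal (‖charFn p ξ‖ ^ 2) :=
      ((continuous_charFn hp.integrable).norm.pow 2).measurable.ennreal_ofReal
    rw [lintegral_mul_const _ hm2]
    gcongr
    exact hp.lintegral_sq_charFn_le hL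
  rw [h1, bias, ← lintegral_add_right' _
    (((hΦ.aemeasurable hK hh).pow_const 2).div_const _).ennreal_ofReal,
    hp.risk_kernelEstimator hL hn hK hΦ hh]
  refine le_trans ?_ (add_le_add_right h2 _)
  rw [← lintegral_add_right _ hmeas]
  refine lintegral_mono fun ξ => ?_
  have ha := hΦ1 ((2 * Real.pi * h) • ξ)
  have hc : ‖charFn p ξ‖ ^ 2 ≤ 1 := by
    have := hp.norm_charFn_le ξ
    have := norm_nonneg (charFn p ξ)
    nlinarith
  set a := Φ ((2 * Real.pi * h) • ξ)
  have hc' : 0 ≤ 1 - ‖charFn p ξ‖ ^ 2 := by linarith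
  rw [← ENNReal.ofReal_add (by positivity) (by positivity),
    ← ENNReal.ofReal_add (by positivity) (by positivity)]
  apply ENNReal.ofReal_le_ofReal
  rw [add_assoc, ← add_div]
  gcongr
  nlinarith [mul_nonneg (sq_nonneg ‖charFn p ξ‖) (by nlinarith : 0 ≤ 1 - a ^ 2)]

/-- At each frequency, 1 - Φ is nonnegative and grows with the bandwidth. This is what permits
rounding a bandwidth down. -/
theorem bias_mono (hΦ1 : ∀ t, 0 ≤ Φ t ∧ Φ t ≤ 1)
    (hmono : ∀ (t : Space d) (h h' : ℝ), 0 < h' → h' < h → Φ (h • t) ≤ Φ (h' • t))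
    {h h' : ℝ} (hh' : 0 < h') (hle : h' ≤ h) : bias Φ p h' ≤ bias Φ p h := by
  rcases hle.eq_or_lt with rfl | hlt
  · exact le_rfl
  refine lintegral_mono fun ξ => ENNReal.ofReal_le_ofReal ?_
  have h1 := hmono ((2 * Real.pi) • ξ) h h' hh' hlt
  rw [smul_smul, smul_smul, mul_comm h, mul_comm h'] at h1
  have h2 := (hΦ1 ((2 * Real.pi * h') • ξ)).2
  gcongr

theorem IsBoundedDensity.bias_le (hp : IsBoundedDensity d L p) (hL : 0 ≤ L)
    (hΦ1 : ∀ t, 0 ≤ Φ t ∧ Φ t ≤ 1) (h : ℝ) : bias Φ p h ≤ ENNReal.ofReal L := by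
  refine le_trans (lintegral_mono fun ξ => ENNReal.ofReal_le_ofReal ?_)
    (hp.lintegral_sq_charFn_le hL)
  have ha := hΦ1 ((2 * Real.pi * h) • ξ)
  refine mul_le_of_le_one_left (sq_nonneg _) ?_
  nlinarith

end KernelRisk

/-! ### Deterministic oracle inequality for one validation sample -/

section Deviation

variable {d l : ℕ} {ι : Type} [Fintype ι] {p : Space d → ℝ} {f : ι → Space d → ℝ}

/-- The mean of `g` over the sample `Y`. -/
def sampleMean (Y : Fin l → Space d) (g : Space d → ℝ) : ℝ := (1 / (l : ℝ)) * ∑ i, g (Y i)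

/-- The deviation of the mean of `g` over the sample `Y` from its expectation under `p`. -/
def noise (p : Space d → ℝ) (Y : Fin l → Space d) (g : Space d → ℝ) : ℝ :=
  sampleMean Y g - ∫ x, p x * g x

/-- The squared norm of the noise, as a linear functional on the span of the functions `f j`
with the norm of `L_2`. -/
def deviation (p : Space d → ℝ) (f : ι → Space d → ℝ) (Y : Fin l → Space d) : ℝ≥0∞ :=
  ⨆ q : ι → ℚ, ENNReal.ofReal (noise p Y (combination f fun j => (q j : ℝ)) ^ 2) /
    ENNReal.ofReal (∫ x, combination f (fun j => (q j : ℝ)) x ^ 2)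

theorem sampleMean_combination (Y : Fin l → Space d) (f : ι → Space d → ℝ) (w : ι → ℝ) :
    sampleMean Y (combination f w) = ∑ j, w j * sampleMean Y (f j) := by
  simp only [sampleMean, combination, Finset.mul_sum]
  rw [Finset.sum_comm]
  refine Finset.sum_congr rfl fun j _ => Finset.sum_congr rfl fun i _ => by ring

theorem memLp_combination (hf : ∀ j, MemLp (f j) 2) (w : ι → ℝ) :
    MemLp (combination f w) 2 := by
  have := memLp_finsetSum (p := 2) (μ := (volume : Measure (Space d))) Finset.univ
    (f := fun j x => w j * f j x) fun j _ => (hf j).const_mul (w j)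
  exact this

theorem integral_mul_combination (hf : ∀ j, MemLp (f j) 2) {g : Space d → ℝ} (hg : MemLp g 2)
    (w : ι → ℝ) :
    ∫ x, g x * combination f w x = ∑ j, w j * ∫ x, g x * f j x := by
  simp only [combination, Finset.mul_sum]
  rw [integral_finsetSum]
  · refine Finset.sum_congr rfl fun j _ => ?_
    rw [← integral_const_mul]
    congr 1 with x
    ring
  · intro j _
    have h1 : Integrable (fun x => g x * f j x) := hg.integrable_mul (hf j)
    refine (h1.const_mul (w j)).congr (Filter.Eventually.of_forall fun x => ?_)
    ring

theorem noise_combination (hp : MemLp p 2) (hf : ∀ j, MemLp (f j) 2) (Y : Fin l → Space d)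
    (w : ι → ℝ) : noise p Y (combination f w) = ∑ j, w j * noise p Y (f j) := by
  simp only [noise, sampleMean_combination, integral_mul_combination hf hp, mul_sub,
    Finset.sum_sub_distrib]

theorem integral_combination_sq (hf : ∀ j, MemLp (f j) 2) (w : ι → ℝ) :
    ∫ x, combination f w x ^ 2 = ∑ j, w j * ∑ k, w k * ∫ x, f j x * f k x := by
  simp only [sq]
  rw [integral_mul_combination hf (memLp_combination hf w)]
  refine Finset.sum_congr rfl fun j _ => ?_
  rw [← integral_mul_combination hf (hf j)]
  simp only [mul_comm (f j _)]

/-- Both sides are continuous in the weights, a squared linear form and a quadratic form, so the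
bound extends from rational to real weights by density. -/
theorem noise_sq_le (hp : MemLp p 2) (hf : ∀ j, MemLp (f j) 2) (Y : Fin l → Space d)
    (hS : deviation p f Y ≠ ∞) (w : ι → ℝ) :
    noise p Y (combination f w) ^ 2
      ≤ (deviation p f Y).toReal * ∫ x, combination f w x ^ 2 := by
  have hcl : IsClosed {w : ι → ℝ | noise p Y (combination f w) ^ 2
      ≤ (deviation p f Y).toReal * ∫ x, combination f w x ^ 2} := by
    simp only [noise_combination hp hf, integral_combination_sq hf]
    exact isClosed_le (by fun_prop) (by fun_prop)
  have hd : DenseRange fun (q : ι → ℚ) (j : ι) => (q j : ℝ) :=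
    DenseRange.piMap fun _ => Rat.denseRange_cast
  refine hd.induction_on (p := fun w => noise p Y (combination f w) ^ 2
      ≤ (deviation p f Y).toReal * ∫ x, combination f w x ^ 2) w hcl fun q => ?_
  have h0 : 0 ≤ ∫ x, combination f (fun j => (q j : ℝ)) x ^ 2 :=
    integral_nonneg fun x => sq_nonneg _
  have h1 : ENNReal.ofReal (noise p Y (combination f fun j => (q j : ℝ)) ^ 2) /
    ENNReal.ofReal (∫ x, combination f (fun j => (q j : ℝ)) x ^ 2) ≤ deviation p f Y :=
    le_iSup (fun q : ι → ℚ => ENNReal.ofReal (noise p Y (combination f fun j => (q j : ℝ)) ^ 2) /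
    ENNReal.ofReal (∫ x, combination f (fun j => (q j : ℝ)) x ^ 2)) q
  -- Finiteness of the supremum covers a zero denominator: a nonzero numerator over zero would be
  -- infinite.
  rw [ENNReal.div_le_iff_le_mul (Or.inr hS) (Or.inl ENNReal.ofReal_ne_top),
    ← ENNReal.ofReal_toReal hS, ← ENNReal.ofReal_mul ENNReal.toReal_nonneg,
    ENNReal.ofReal_le_ofReal_iff (mul_nonneg ENNReal.toReal_nonneg h0)] at h1
  exact h1

theorem lintegral_sq_sub_eq {g : Space d → ℝ} (hg : MemLp g 2) (hp : MemLp p 2) :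
    ∫⁻ x, ENNReal.ofReal ((g x - p x) ^ 2) = ENNReal.ofReal (∫ x, (g x - p x) ^ 2) :=
  (ofReal_integral_eq_lintegral_ofReal (hg.sub hp).integrable_sq
    (Filter.Eventually.of_forall fun x => sq_nonneg (g x - p x))).symm

theorem integral_add_mul_sq {u v : Space d → ℝ} (hu : MemLp u 2) (hv : MemLp v 2) (t : ℝ) :
    ∫ x, (u x + t * v x) ^ 2
      = (∫ x, u x ^ 2) + 2 * t * (∫ x, u x * v x) + t ^ 2 * ∫ x, v x ^ 2 := by
  have i1 : Integrable fun x => u x ^ 2 := hu.integrable_sq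
  have i2 : Integrable fun x => t ^ 2 * v x ^ 2 := hv.integrable_sq.const_mul _
  have i3 : Integrable fun x => 2 * t * (u x * v x) := (hu.integrable_mul hv).const_mul _
  have i4 : Integrable fun x => u x ^ 2 + 2 * t * (u x * v x) := i1.add i3
  rw [← integral_const_mul, ← integral_const_mul, ← integral_add i1 i3, ← integral_add i4 i2]
  congr 1 with x
  ring

/-- An element of the span satisfying the first order condition towards another element has
nearly as small a loss. -/
theorem loss_le_of_first_order (hp : MemLp p 2) (hf : ∀ j, MemLp (f j) 2) (Y : Fin l → Space d)
    (a b : ι → ℝ)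
    (hab : sampleMean Y (combination f (b - a))
      ≤ ∫ x, combination f a x * combination f (b - a) x) :
    ∫⁻ x, ENNReal.ofReal ((combination f a x - p x) ^ 2)
      ≤ (∫⁻ x, ENNReal.ofReal ((combination f b x - p x) ^ 2)) + deviation p f Y := by
  -- Infinite when a combination vanishing almost everywhere has nonzero mean over the sample; the
  -- claim is then trivial.
  by_cases hS : deviation p f Y = ∞
  · rw [hS, add_top]; exact le_top
  have ha := memLp_combination hf a
  have hb := memLp_combination hf b
  have hv := memLp_combination hf (b - a)
  have hN := noise_sq_le hp hf Y hS (b - a)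
  rw [lintegral_sq_sub_eq ha hp, lintegral_sq_sub_eq hb hp]
  nth_rewrite 1 [← ENNReal.ofReal_toReal hS]
  rw [← ENNReal.ofReal_add (integral_nonneg fun x => sq_nonneg _) ENNReal.toReal_nonneg]
  apply ENNReal.ofReal_le_ofReal
  have hvx : ∀ x, combination f b x = combination f a x + combination f (b - a) x := by
    intro x
    simp only [combination, Pi.sub_apply, ← Finset.sum_add_distrib]
    exact Finset.sum_congr rfl fun j _ => by ring
  have hap : MemLp (fun x => combination f a x - p x) 2 := ha.sub hp
  have i3 : Integrable fun x => combination f a x * combination f (b - a) x :=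
    ha.integrable_mul hv
  have i4 : Integrable fun x => p x * combination f (b - a) x := hp.integrable_mul hv
  have hexp : ∫ x, (combination f b x - p x) ^ 2
      = (∫ x, (combination f a x - p x) ^ 2)
        + 2 * ((∫ x, combination f a x * combination f (b - a) x)
          - ∫ x, p x * combination f (b - a) x) + ∫ x, combination f (b - a) x ^ 2 := by
    have h1 := integral_add_mul_sq hap hv 1
    simp only [one_mul, one_pow, mul_one, sub_mul] at h1
    rw [integral_sub i3 i4] at h1
    rw [← h1]
    congr 1 with x
    rw [hvx]
    ring
  have hN0 : 0 ≤ ∫ x, combination f (b - a) x ^ 2 := integral_nonneg fun x => sq_nonneg _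
  have hn : noise p Y (combination f (b - a)) = sampleMean Y (combination f (b - a))
      - ∫ x, p x * combination f (b - a) x := rfl
  -- Writing D for the deviation and V = ‖f_b - f_a‖²: (2 noise)² ≤ 4DV ≤ (D + V)², and V is exactly
  -- what the expansion `hexp` provides.
  have h2 : -(2 * noise p Y (combination f (b - a)))
      ≤ (deviation p f Y).toReal + ∫ x, combination f (b - a) x ^ 2 := by
    refine (abs_le_of_sq_le_sq' ?_ (by positivity)).1 |> neg_le.1
    nlinarith [sq_nonneg ((deviation p f Y).toReal - ∫ x, combination f (b - a) x ^ 2)]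
  rw [hexp]
  linarith

/-- Deterministic oracle inequality for the aggregates of both kinds. -/
theorem IsAggregate.loss_le {kind : Kind} {A : (Fin l → Space d) → Space d → ℝ}
    (hA : IsAggregate kind f A) (hp : MemLp p 2) (hf : ∀ j, MemLp (f j) 2)
    (Y : Fin l → Space d) :
    MemLp (A Y) 2 ∧ ∀ j, ∫⁻ x, ENNReal.ofReal ((A Y x - p x) ^ 2)
      ≤ (∫⁻ x, ENNReal.ofReal ((f j x - p x) ^ 2)) + deviation p f Y := by
  classical
  cases kind with
  | linear =>
    obtain ⟨r, φ, hspan, horth, hrep, hT⟩ := hA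
    -- The basis lies in the span of the functions, not only of their classes, so these identities
    -- hold at every point, in particular at the observations.
    have hφ : ∀ k, ∃ c : ι → ℝ, φ k = combination f c := by
      intro k
      obtain ⟨c, hc⟩ := (Submodule.mem_span_range_iff_exists_fun ℝ).1 (hspan k)
      refine ⟨c, ?_⟩
      rw [← hc]
      funext x
      simp [combination]
    choose c hc using hφ
    have hφL : ∀ k, MemLp (φ k) 2 := fun k => by rw [hc k]; exact memLp_combination hf _
    have hcomb : ∀ b : Fin r → ℝ, combination φ b = combination f fun j => ∑ k, b k * c k j := by
      intro b
      funext x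
      simp only [combination, Finset.sum_mul]
      rw [Finset.sum_comm]
      refine Finset.sum_congr rfl fun k _ => ?_
      rw [hc k, combination, Finset.mul_sum]
      exact Finset.sum_congr rfl fun j _ => by ring
    have hAY : A Y = combination φ fun k => sampleMean Y (φ k) := by
      funext x; rw [hT]; rfl
    refine ⟨by rw [hAY]; exact memLp_combination hφL _, fun j => ?_⟩
    obtain ⟨b, hb⟩ := hrep j
    have e1 : ∫⁻ x, ENNReal.ofReal ((f j x - p x) ^ 2)
        = ∫⁻ x, ENNReal.ofReal ((combination φ b x - p x) ^ 2) := by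
      apply lintegral_congr_ae
      filter_upwards [hb] with x hx
      rw [hx]; rfl
    rw [e1, hAY, hcomb, hcomb]
    -- The coefficients of the projection estimator are the sample means of the basis, so the first
    -- order condition is an equality in all directions of the span.
    refine loss_le_of_first_order hp hf Y _ _ (le_of_eq ?_)
    have e2 : (fun j => ∑ k, b k * c k j) - (fun j => ∑ k, sampleMean Y (φ k) * c k j)
        = fun j => ∑ k, (b k - sampleMean Y (φ k)) * c k j := by
      funext j
      simp [sub_mul]
    rw [e2, ← hcomb, ← hcomb, sampleMean_combination, integral_mul_combination hφL
      (memLp_combination hφL _)]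
    refine Finset.sum_congr rfl fun k _ => ?_
    congr 1
    simp only [mul_comm _ (φ k _)]
    rw [integral_mul_combination hφL (hφL k)]
    simp [horth]
  | convex =>
    obtain ⟨w, hw⟩ := hA
    obtain ⟨⟨hw0, hw1⟩, hmin, hT⟩ := hw Y
    refine ⟨by rw [hT]; exact memLp_combination hf _, fun j => ?_⟩
    set v : ι → ℝ := Pi.single j 1 with hv
    have hvf : f j = combination f v := by
      funext x; simp [combination, hv, Pi.single_apply]
    have hv0 : ∀ k, 0 ≤ v k := fun k => by
      rw [hv, Pi.single_apply]; split_ifs <;> norm_num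
    have hv1 : ∑ k, v k ≤ 1 := by simp [hv]
    rw [hT, hvf]
    refine loss_le_of_first_order hp hf Y _ _ ?_
    set δ := v - w Y with hδ
    set I := ∫ x, combination f (w Y) x * combination f δ x with hI
    set J := ∫ x, combination f δ x ^ 2 with hJ
    have hcrit : ∀ t : ℝ, criterion f Y (w Y + t • δ) = criterion f Y (w Y)
        + 2 * t * (I - sampleMean Y (combination f δ)) + t ^ 2 * J := by
      intro t
      have hpt : combination f (w Y + t • δ)
          = fun x => combination f (w Y) x + t * combination f δ x := by
        funext x
        simp only [combination, Pi.add_apply, Pi.smul_apply, smul_eq_mul, Finset.mul_sum,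
          ← Finset.sum_add_distrib]
        exact Finset.sum_congr rfl fun k _ => by ring
      have e1 : ∫ x, combination f (w Y + t • δ) x ^ 2
          = (∫ x, combination f (w Y) x ^ 2) + 2 * t * I + t ^ 2 * J := by
        rw [hpt, integral_add_mul_sq (memLp_combination hf (w Y)) (memLp_combination hf δ)]
      rw [criterion, criterion, e1, hpt, sampleMean, Finset.sum_add_distrib, ← Finset.mul_sum]
      ring
    have hfeas : ∀ t : ℝ, 0 ≤ t → t ≤ 1 → w Y + t • δ ∈ weightSimplex ι := by
      intro t ht0 ht1
      have hk : ∀ k, (w Y + t • δ) k = (1 - t) * w Y k + t * v k := fun k => by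
        simp [hδ]; ring
      refine ⟨fun k => ?_, ?_⟩
      · rw [hk]
        exact add_nonneg (mul_nonneg (by linarith) (hw0 k)) (mul_nonneg ht0 (hv0 k))
      · simp only [hk, Finset.sum_add_distrib, ← Finset.mul_sum]
        nlinarith
    have hJ0 : 0 ≤ J := integral_nonneg fun x => sq_nonneg _
    -- Otherwise the criterion decreases towards the vertex `v`. The step t = D / (D + J) is
    -- feasible even for J = 0, and tJ ≤ D makes the change t (tJ - 2D) negative, against
    -- minimality.
    by_contra hlt
    rw [not_le] at hlt
    set D := sampleMean Y (combination f δ) - I with hD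
    have hD0 : 0 < D := by rw [hD]; linarith
    have ht0 : 0 < D / (D + J) := by positivity
    have ht1 : D / (D + J) ≤ 1 := (div_le_one (by positivity)).2 (by linarith)
    have h1 := hmin _ (hfeas _ ht0.le ht1)
    rw [hcrit] at h1
    have h2 : D / (D + J) * (D + J) = D := by field_simp
    set t := D / (D + J)
    have h3 : 0 ≤ t * (t * J - 2 * D) := by
      have : I - sampleMean Y (combination f δ) = -D := by rw [hD]; ring
      rw [this] at h1
      nlinarith
    have h4 : t * J - 2 * D < 0 := by nlinarith
    nlinarith

end Deviation

/-! ### Expected deviation -/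

section ExpectedDeviation

variable {d l : ℕ} {L : ℝ} {ι : Type} [Fintype ι] {p : Space d → ℝ} {f : ι → Space d → ℝ}

theorem inner_L2_eq (u v : Lp ℝ 2 (volume : Measure (Space d))) :
    inner ℝ u v = ∫ x, u x * v x := by
  rw [L2.inner_def]
  congr 1 with x
  exact mul_comm (v x) (u x)

/-- Finitely many functions in `L_2` are combinations of at most as many orthonormal functions. -/
theorem exists_orthonormal_functions (hf : ∀ j, MemLp (f j) 2) :
    ∃ (r : ℕ) (φ : Fin r → Space d → ℝ) (c : ι → Fin r → ℝ), r ≤ Fintype.card ι ∧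
      (∀ k, MemLp (φ k) 2) ∧ (∀ i k, ∫ x, φ i x * φ k x = if i = k then 1 else 0) ∧
      ∀ j, f j =ᵐ[volume] combination φ (c j) := by
  set F : ι → Lp ℝ 2 (volume : Measure (Space d)) := fun j => (hf j).toLp (f j) with hF
  set W := Submodule.span ℝ (Set.range F)
  have : FiniteDimensional ℝ W := FiniteDimensional.span_of_finite ℝ (Set.finite_range F)
  obtain ⟨b⟩ : Nonempty (OrthonormalBasis (Fin (Module.finrank ℝ W)) ℝ W) :=
    ⟨stdOrthonormalBasis ℝ W⟩
  have hFW : ∀ j, F j ∈ W := fun j => Submodule.subset_span (Set.mem_range_self j)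
  refine ⟨Module.finrank ℝ W, fun k => ⇑(b k : Lp ℝ 2 (volume : Measure (Space d))),
    fun j k => b.repr ⟨F j, hFW j⟩ k, ?_, fun k => Lp.memLp _, fun i k => ?_, fun j => ?_⟩
  · exact finrank_range_le_card F
  · have h1 := orthonormal_iff_ite.1 b.orthonormal i k
    rw [← h1, Submodule.coe_inner, inner_L2_eq]
  · have h1 : F j = ∑ k, b.repr ⟨F j, hFW j⟩ k • (b k : Lp ℝ 2 (volume : Measure (Space d))) := by
      have := congrArg (Subtype.val) (b.sum_repr ⟨F j, hFW j⟩)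
      refine Eq.trans this.symm ?_
      simp
    have h2 := Lp.coeFn_finsetSum (p := 2) Finset.univ
      (fun k => b.repr ⟨F j, hFW j⟩ k • (b k : Lp ℝ 2 (volume : Measure (Space d))))
    rw [← h1] at h2
    have h3 := ae_all_iff.2 fun k => Lp.coeFn_smul (b.repr ⟨F j, hFW j⟩ k)
      (b k : Lp ℝ 2 (volume : Measure (Space d)))
    filter_upwards [(hf j).coeFn_toLp, h2, h3] with x e1 e2 e3
    refine e1.symm.trans (e2.trans ?_)
    rw [Finset.sum_apply]
    exact Finset.sum_congr rfl fun k _ => e3 k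

theorem sum_mul_sq_le {r : ℕ} (a b : Fin r → ℝ) :
    (∑ k, a k * b k) ^ 2 ≤ (∑ k, a k ^ 2) * ∑ k, b k ^ 2 :=
  Finset.sum_mul_sq_le_sq_mul_sq _ _ _

/-- The variance of one term is at most ∫ p g² ≤ L ‖g‖² = L. -/
theorem IsBoundedDensity.lintegral_noise_sq_le (hp : IsBoundedDensity d L p) (hL : 0 ≤ L)
    (hl : l ≠ 0) {g : Space d → ℝ} (hg : MemLp g 2) (hg1 : ∫ x, g x * g x = 1) :
    AEMeasurable (fun Y : Fin l → Space d => ENNReal.ofReal (noise p Y g ^ 2)) (sampleLaw l p) ∧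
    ∫⁻ Y : Fin l → Space d, ENNReal.ofReal (noise p Y g ^ 2) ∂(sampleLaw l p)
      ≤ ENNReal.ofReal (L / l) := by
  have := hp.isProbabilityMeasure
  have hgμ := hp.memLp_densityMeasure hL hg
  have hmean : ∫ x, g x ∂(densityMeasure p) = ∫ x, p x * g x := by
    rw [hp.integral_densityMeasure]; rfl
  obtain ⟨i1, e1⟩ := integral_sampleMean_sub_sq hl hgμ (∫ x, p x * g x)
  have hnoise : (fun Y : Fin l → Space d => noise p Y g ^ 2)
      = fun Y => ((1 / (l : ℝ)) * ∑ i, g (Y i) - ∫ x, p x * g x) ^ 2 := rfl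
  rw [← hnoise] at i1
  refine ⟨i1.aestronglyMeasurable.aemeasurable.ennreal_ofReal, ?_⟩
  rw [sampleLaw_eq, ← ofReal_integral_eq_lintegral_ofReal i1
    (Filter.Eventually.of_forall fun Y => sq_nonneg _)]
  apply ENNReal.ofReal_le_ofReal
  rw [hnoise, e1, hmean, sub_self]
  have h2 : ∫ x, g x ^ 2 ∂(densityMeasure p) ≤ L := by
    rw [hp.integral_densityMeasure]
    calc ∫ x, p x • g x ^ 2 ≤ ∫ x, L * (g x * g x) := by
          refine integral_mono_of_nonneg (Filter.Eventually.of_forall fun x =>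
            mul_nonneg (hp.nonneg x) (sq_nonneg _)) ((hg.integrable_mul hg).const_mul L) ?_
          filter_upwards [hp.ae_le hL] with x hx
          rw [smul_eq_mul, sq]
          exact mul_le_mul_of_nonneg_right hx (mul_self_nonneg _)
      _ = L := by rw [integral_const_mul, hg1, mul_one]
  have h3 := sq_nonneg (∫ x, p x * g x)
  have : (0 : ℝ) < l := by positivity
  norm_num
  gcongr
  linarith

/-- By Cauchy-Schwarz in an orthonormal basis, the squared norm of the noise is at most the sum of
its squares on the basis, which has at most `card ι` elements. The basis represents the functions
only almost everywhere; this suffices because the observations almost surely avoid a given null set.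
-/
theorem IsBoundedDensity.lintegral_deviation_le (hp : IsBoundedDensity d L p) (hL : 0 ≤ L)
    (hl : l ≠ 0) (hf : ∀ j, MemLp (f j) 2) :
    ∫⁻ Y : Fin l → Space d, deviation p f Y ∂(sampleLaw l p)
      ≤ ENNReal.ofReal (L * Fintype.card ι / l) := by
  have := hp.isProbabilityMeasure
  have hp2 := hp.memLp hL
  obtain ⟨r, φ, c, hr, hφ, horth, hrep⟩ := exists_orthonormal_functions hf
  have hae : ∀ᵐ Y : Fin l → Space d ∂(sampleLaw l p), ∀ i j, f j (Y i) = combination φ (c j) (Y i) := by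
    rw [ae_all_iff]; intro i
    rw [ae_all_iff]; intro j
    have h1 : ∀ᵐ x ∂(densityMeasure p), f j x = combination φ (c j) x :=
      (densityMeasure_absolutelyContinuous p).ae_le (hrep j)
    exact (measurePreserving_eval (fun _ : Fin l => densityMeasure p) i).quasiMeasurePreserving.ae h1
  have hbound : ∀ᵐ Y : Fin l → Space d ∂(sampleLaw l p),
      deviation p f Y ≤ ∑ k, ENNReal.ofReal (noise p Y (φ k) ^ 2) := by
    filter_upwards [hae] with Y hY
    refine iSup_le fun q => ?_
    set b : Fin r → ℝ := fun k => ∑ j, (q j : ℝ) * c j k with hb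
    have hcomb : ∀ x, ∑ j, (q j : ℝ) * combination φ (c j) x = combination φ b x := by
      intro x
      simp only [combination, hb, Finset.mul_sum, Finset.sum_mul]
      rw [Finset.sum_comm]
      exact Finset.sum_congr rfl fun k _ => Finset.sum_congr rfl fun j _ => by ring
    have hcombae : combination f (fun j => (q j : ℝ)) =ᵐ[volume] combination φ b := by
      filter_upwards [ae_all_iff.2 hrep] with x hx
      rw [← hcomb, combination]
      exact Finset.sum_congr rfl fun j _ => by rw [hx]
    have hn : noise p Y (combination f fun j => (q j : ℝ)) = ∑ k, b k * noise p Y (φ k) := by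
      rw [← noise_combination hp2 hφ, noise, noise]
      congr 1
      · rw [sampleMean, sampleMean]
        congr 1
        refine Finset.sum_congr rfl fun i _ => ?_
        rw [← hcomb, combination]
        exact Finset.sum_congr rfl fun j _ => by rw [hY]
      · apply integral_congr_ae
        filter_upwards [hcombae] with x hx
        rw [hx]
    have hsq : ∫ x, combination f (fun j => (q j : ℝ)) x ^ 2 = ∑ k, b k ^ 2 := by
      have : ∫ x, combination f (fun j => (q j : ℝ)) x ^ 2 = ∫ x, combination φ b x ^ 2 := by
        apply integral_congr_ae
        filter_upwards [hcombae] with x hx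
        rw [hx]
      rw [this, integral_combination_sq hφ]
      simp [horth, sq]
    rw [hn, hsq, ← ENNReal.ofReal_sum_of_nonneg fun k _ => sq_nonneg _]
    refine ENNReal.div_le_of_le_mul ?_
    rw [← ENNReal.ofReal_mul (Finset.sum_nonneg fun k _ => sq_nonneg _), mul_comm (∑ k, noise _ _ _ ^ 2)]
    exact ENNReal.ofReal_le_ofReal (sum_mul_sq_le _ _)
  have hk := fun k => hp.lintegral_noise_sq_le hL hl (hφ k) (by simp [horth])
  calc ∫⁻ Y : Fin l → Space d, deviation p f Y ∂(sampleLaw l p)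
      ≤ ∫⁻ Y : Fin l → Space d, ∑ k, ENNReal.ofReal (noise p Y (φ k) ^ 2) ∂(sampleLaw l p) :=
        lintegral_mono_ae hbound
    _ = ∑ k, ∫⁻ Y : Fin l → Space d, ENNReal.ofReal (noise p Y (φ k) ^ 2) ∂(sampleLaw l p) :=
        lintegral_finsetSum' _ fun k _ => (hk k).1
    _ ≤ ∑ _k : Fin r, ENNReal.ofReal (L / l) := Finset.sum_le_sum fun k _ => (hk k).2
    _ = ENNReal.ofReal (L * r / l) := by
        rw [Finset.sum_const, Finset.card_univ, Fintype.card_fin, nsmul_eq_mul,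
          ← ENNReal.ofReal_natCast, ← ENNReal.ofReal_mul (by positivity)]
        congr 1; ring
    _ ≤ ENNReal.ofReal (L * Fintype.card ι / l) := by
        apply ENNReal.ofReal_le_ofReal
        gcongr

end ExpectedDeviation

/-! ### Joint measurability in the training and validation samples -/

section Measurability

variable {d m l : ℕ} {L : ℝ} {ι : Type} [Fintype ι] {p : Space d → ℝ}

/-- The kernel is measurable only up to a null set. Composition is legitimate because (Z, x) ↦ (Z_i
- x) / h pulls null sets back to null sets, as it does in x for each fixed Z. -/
theorem aestronglyMeasurable_kernelEstimator {K : Space d → ℝ} (hK : AEStronglyMeasurable K volume)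
    {h : ℝ} (hh : 0 < h) (P : Measure (Fin m → Space d)) [SFinite P] :
    AEStronglyMeasurable (fun q : (Fin m → Space d) × Space d => kernelEstimator K h q.1 q.2)
      (P.prod volume) := by
  have h1 : ∀ i : Fin m, AEStronglyMeasurable
      (fun q : (Fin m → Space d) × Space d => K (dilation h (q.1 i) q.2)) (P.prod volume) := by
    intro i
    have hq : Measure.QuasiMeasurePreserving
        (fun q : (Fin m → Space d) × Space d => dilation h (q.1 i) q.2) (P.prod volume) volume := by
      refine QuasiMeasurePreserving.prod_of_right ?_
        (Filter.Eventually.of_forall fun Z => quasiMeasurePreserving_dilation hh (Z i))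
      unfold dilation
      fun_prop
    exact hK.comp_quasiMeasurePreserving hq
  have h2 : AEStronglyMeasurable
      (fun q : (Fin m → Space d) × Space d => ∑ i, K (dilation h (q.1 i) q.2)) (P.prod volume) :=
    Finset.aestronglyMeasurable_fun_sum _ fun i _ => h1 i
  exact h2.const_mul _

/-- The supremum runs over countably many rational weights. Evaluation at an observation respects
null sets since its law is absolutely continuous. -/
theorem aemeasurable_deviation {α : Type*} [MeasurableSpace α] {P : Measure α}
    [IsProbabilityMeasure P] (hp : IsBoundedDensity d L p) {f : ι → α → Space d → ℝ}
    (hf : ∀ j, AEStronglyMeasurable (fun q : α × Space d => f j q.1 q.2) (P.prod volume)) :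
    AEMeasurable (fun q : α × (Fin l → Space d) => deviation p (fun j => f j q.1) q.2)
      (P.prod (sampleLaw l p)) := by
  have := hp.isProbabilityMeasure
  have hPl : IsProbabilityMeasure (sampleLaw l p) := by rw [sampleLaw_eq]; infer_instance
  refine AEMeasurable.iSup fun w => ?_
  have h1 : AEStronglyMeasurable (fun q : α × Space d =>
      combination (fun j => f j q.1) (fun j => (w j : ℝ)) q.2) (P.prod volume) :=
    Finset.aestronglyMeasurable_fun_sum _ fun j _ => (hf j).const_mul (w j : ℝ)
  have h2 : AEMeasurable (fun z : α => ∫ x, combination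
      (fun j => f j z) (fun j => (w j : ℝ)) x ^ 2) P :=
    (h1.pow 2).integral_prod_right'.aemeasurable
  have h3 : AEMeasurable (fun z : α => ∫ x, p x * combination
      (fun j => f j z) (fun j => (w j : ℝ)) x) P :=
    (hp.integrable.aestronglyMeasurable.comp_snd.mul h1).integral_prod_right'.aemeasurable
  have h4 : ∀ i : Fin l, AEMeasurable (fun q : α × (Fin l → Space d) =>
      combination (fun j => f j q.1) (fun j => (w j : ℝ)) (q.2 i)) (P.prod (sampleLaw l p)) := by
    intro i
    have e1 : MeasurePreserving (fun Y : Fin l → Space d => Y i) (sampleLaw l p)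
        (densityMeasure p) := measurePreserving_eval (fun _ : Fin l => densityMeasure p) i
    have e2 : MeasurePreserving (fun q : α × (Fin l → Space d) => (q.1, q.2 i))
        (P.prod (sampleLaw l p)) (P.prod (densityMeasure p)) := (MeasurePreserving.id P).prod e1
    have e3 : P.prod (densityMeasure p) ≪ P.prod volume :=
      Measure.AbsolutelyContinuous.rfl.prod (densityMeasure_absolutelyContinuous p)
    exact (h1.mono_ac e3).aemeasurable.comp_quasiMeasurePreserving e2.quasiMeasurePreserving
  have h5 : AEMeasurable (fun q : α × (Fin l → Space d) =>
      noise p q.2 (combination (fun j => f j q.1) (fun j => (w j : ℝ))))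
      (P.prod (sampleLaw l p)) := by
    have e0 : AEMeasurable (fun q : α × (Fin l → Space d) =>
        ∑ i, combination (fun j => f j q.1) (fun j => (w j : ℝ)) (q.2 i))
        (P.prod (sampleLaw l p)) := Finset.aemeasurable_fun_sum _ fun i _ => h4 i
    exact (e0.const_mul (1 / (l : ℝ))).sub h3.comp_fst
  exact (h5.pow_const 2).ennreal_ofReal.div h2.ennreal_ofReal.comp_fst

end Measurability

/-! ### Oracle inequality in expectation, averaged over splits -/

section Splitting

variable {d n m l : ℕ} {L : ℝ} {ι : Type} [Fintype ι] {p : Space d → ℝ}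

/-- The two subsamples of a split are independent samples. -/
theorem IsBoundedDensity.measurePreserving_split (hp : IsBoundedDensity d L p) (S : Split n m l) :
    MeasurePreserving (fun X : Fin n → Space d => (S.train X, S.valid X)) (sampleLaw n p)
      ((sampleLaw m p).prod (sampleLaw l p)) := by
  have := hp.isProbabilityMeasure
  have h1 := (measurePreserving_piCongrLeft (fun _ : Fin n => densityMeasure p) S).symm
  have h2 := measurePreserving_sumPiEquivProdPi (fun _ : Fin m ⊕ Fin l => densityMeasure p)
  exact h2.comp h1

/-- Convexity of the square: the loss of a mean is at most the mean of the losses. -/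
theorem sq_sampleAverage_sub_le {α : Type*} {s : Finset α} (hs : s.Nonempty) (u : α → ℝ) (b : ℝ) :
    ((1 / (s.card : ℝ)) * ∑ i ∈ s, u i - b) ^ 2
      ≤ (1 / (s.card : ℝ)) * ∑ i ∈ s, (u i - b) ^ 2 := by
  have hc : (0 : ℝ) < s.card := by exact_mod_cast hs.card_pos
  have h1 : (1 / (s.card : ℝ)) * ∑ i ∈ s, u i - b = (1 / (s.card : ℝ)) * ∑ i ∈ s, (u i - b) := by
    rw [Finset.sum_sub_distrib, Finset.sum_const, nsmul_eq_mul]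
    field_simp
  rw [h1, mul_pow]
  have h2 := sq_sum_le_card_mul_sum_sq (s := s) (f := fun i => u i - b)
  calc (1 / (s.card : ℝ)) ^ 2 * (∑ i ∈ s, (u i - b)) ^ 2
      ≤ (1 / (s.card : ℝ)) ^ 2 * (s.card * ∑ i ∈ s, (u i - b) ^ 2) := by gcongr
    _ = _ := by field_simp

/-- Oracle inequality for averaged aggregates of kernel estimators. -/
theorem IsBoundedDensity.risk_averagedAggregate_le (hp : IsBoundedDensity d L p) (hL : 0 ≤ L)
    (hm : m ≠ 0) (hl : l ≠ 0) {K : ι → Space d → ℝ} (hK : ∀ j, MemLp (K j) 2)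
    (hF : ∀ j, ∃ Φ, IsFourierVersion (K j) Φ) {h : ι → ℝ} (hh : ∀ j, 0 < h j)
    {kind : Kind} {𝒮 : Finset (Split n m l)} (h𝒮 : 𝒮.Nonempty) {T : (Fin n → Space d) → Space d → ℝ}
    (hT : IsAveragedAggregate kind 𝒮 (fun j => kernelEstimator (K j) (h j)) T) (j : ι) :
    risk T p ≤ risk (fun Z : Fin m → Space d => kernelEstimator (K j) (h j) Z) p
      + ENNReal.ofReal (L * Fintype.card ι / l) := by
  have := hp.isProbabilityMeasure
  have hPm : IsProbabilityMeasure (sampleLaw m p) := by rw [sampleLaw_eq]; infer_instance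
  have hPl : IsProbabilityMeasure (sampleLaw l p) := by rw [sampleLaw_eq]; infer_instance
  have hp2 := hp.memLp hL
  obtain ⟨A, hA, hTA⟩ := hT
  obtain ⟨Φ, hΦ⟩ := hF j
  set f : ι → (Fin m → Space d) → Space d → ℝ := fun j => kernelEstimator (K j) (h j) with hf
  have hfL : ∀ Z j, MemLp (f j Z) 2 := fun Z j => memLp_kernelEstimator (hK j) (hh j) Z
  -- A measurable majorant of the loss of one aggregate. Monotonicity of the upper integral then
  -- dispenses with measurability of the aggregate in the sample.
  set G : (Fin m → Space d) × (Fin l → Space d) → ℝ≥0∞ := fun q =>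
    (∫⁻ x, ENNReal.ofReal ((f j q.1 x - p x) ^ 2)) + deviation p (fun j => f j q.1) q.2 with hG
  have hloss := hp.aemeasurable_loss_kernelEstimator hL hm (hK j) hΦ (hh j)
  have hdev : AEMeasurable (fun q : (Fin m → Space d) × (Fin l → Space d) =>
      deviation p (fun j => f j q.1) q.2) ((sampleLaw m p).prod (sampleLaw l p)) :=
    aemeasurable_deviation hp fun j =>
      aestronglyMeasurable_kernelEstimator (hK j).aestronglyMeasurable (hh j) _
  have hGm : AEMeasurable G ((sampleLaw m p).prod (sampleLaw l p)) := hloss.comp_fst.add hdev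
  have hGint : ∫⁻ q, G q ∂((sampleLaw m p).prod (sampleLaw l p))
      ≤ risk (f j) p + ENNReal.ofReal (L * Fintype.card ι / l) := by
    rw [lintegral_prod _ hGm]
    calc _ ≤ ∫⁻ Z, ((∫⁻ x, ENNReal.ofReal ((f j Z x - p x) ^ 2))
            + ENNReal.ofReal (L * Fintype.card ι / l)) ∂(sampleLaw m p) := by
          refine lintegral_mono fun Z => ?_
          simp only [hG]
          rw [lintegral_add_left measurable_const, lintegral_const, measure_univ, mul_one]
          gcongr
          exact hp.lintegral_deviation_le hL hl (hfL Z)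
      _ = _ := by
          rw [lintegral_add_right _ measurable_const, lintegral_const, measure_univ, mul_one]
          rfl
  have hc0 : (𝒮.card : ℝ≥0∞) ≠ 0 := by exact_mod_cast h𝒮.card_pos.ne'
  have hpt : ∀ X, ∫⁻ x, ENNReal.ofReal ((T X x - p x) ^ 2)
      ≤ (𝒮.card : ℝ≥0∞)⁻¹ * ∑ S ∈ 𝒮, G (S.train X, S.valid X) := by
    intro X
    have hagg : ∀ S ∈ 𝒮, _ := fun S hS =>
      IsAggregate.loss_le (hA S hS (S.train X)) hp2 (hfL (S.train X)) (S.valid X)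
    calc ∫⁻ x, ENNReal.ofReal ((T X x - p x) ^ 2)
        ≤ ∫⁻ x, (𝒮.card : ℝ≥0∞)⁻¹ * ∑ S ∈ 𝒮,
            ENNReal.ofReal ((A S (S.train X) (S.valid X) x - p x) ^ 2) := by
          refine lintegral_mono fun x => ?_
          rw [← ENNReal.ofReal_sum_of_nonneg fun S _ => sq_nonneg _, ← ENNReal.ofReal_natCast,
            ← ENNReal.ofReal_inv_of_pos (by exact_mod_cast h𝒮.card_pos),
            ← ENNReal.ofReal_mul (by positivity)]
          apply ENNReal.ofReal_le_ofReal
          rw [hTA, ← one_div]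
          exact sq_sampleAverage_sub_le h𝒮 _ _
      _ = (𝒮.card : ℝ≥0∞)⁻¹ * ∑ S ∈ 𝒮,
            ∫⁻ x, ENNReal.ofReal ((A S (S.train X) (S.valid X) x - p x) ^ 2) := by
          rw [lintegral_const_mul' _ _ (ENNReal.inv_ne_top.2 hc0), lintegral_finsetSum']
          intro S hS
          exact (((hagg S hS).1.aestronglyMeasurable.sub
            hp2.aestronglyMeasurable).aemeasurable.pow_const 2).ennreal_ofReal
      _ ≤ _ := by
          gcongr with S hS
          exact (hagg S hS).2 j
  calc risk T p ≤ ∫⁻ X, (𝒮.card : ℝ≥0∞)⁻¹ * ∑ S ∈ 𝒮, G (S.train X, S.valid X) ∂(sampleLaw n p) :=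
        lintegral_mono hpt
    _ = (𝒮.card : ℝ≥0∞)⁻¹ * ∑ S ∈ 𝒮, ∫⁻ X, G (S.train X, S.valid X) ∂(sampleLaw n p) := by
        rw [lintegral_const_mul' _ _ (ENNReal.inv_ne_top.2 hc0), lintegral_finsetSum']
        intro S _
        exact hGm.comp_quasiMeasurePreserving (hp.measurePreserving_split S).quasiMeasurePreserving
    -- Only linearity is used across splits, so their dependence is harmless; each maps the sample
    -- to two independent ones with the same product law.
    _ ≤ (𝒮.card : ℝ≥0∞)⁻¹ * ∑ _S ∈ 𝒮, (risk (f j) p + ENNReal.ofReal (L * Fintype.card ι / l)) := by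
        gcongr with S _
        refine le_trans (le_of_eq ?_) hGint
        have hS := hp.measurePreserving_split S
        rw [← hS.map_eq, lintegral_map' (by rw [hS.map_eq]; exact hGm) hS.aemeasurable]
    _ = _ := by
        rw [Finset.sum_const, nsmul_eq_mul, ← mul_assoc,
          ENNReal.inv_mul_cancel hc0 (ENNReal.natCast_ne_top _), one_mul]

end Splitting

/-! ### Sizes of the subsamples -/

section Sizes

variable {n : ℕ}

theorem trainSize_le (hn : 4 ≤ Real.log n) : (trainSize n : ℝ) ≤ n * (1 - (Real.log n)⁻¹) := by
  refine Nat.floor_le (mul_nonneg (Nat.cast_nonneg n) ?_)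
  have : (Real.log n)⁻¹ ≤ 1 := inv_le_one_of_one_le₀ (by linarith)
  linarith

theorem natCast_pos_of_log (hn : 4 ≤ Real.log n) : (0 : ℝ) < n := by
  rcases Nat.eq_zero_or_pos n with rfl | h
  -- `Real.log 0 = 0`, so the lower bound on the logarithm excludes an empty sample.
  · norm_num at hn
  · exact_mod_cast h

/-- With x = 1 / log n, the floor loses at most 1 ≤ n x, so m ≥ n (1 - 2x); and (1 - 2x)(1 + 4x) ≥ 1
for x ≤ 1/4. -/
theorem le_trainSize_mul (hn : 4 ≤ Real.log n) :
    (n : ℝ) ≤ trainSize n * (1 + 4 * (Real.log n)⁻¹) := by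
  have hn0 := natCast_pos_of_log hn
  set x := (Real.log n)⁻¹ with hx
  have hx0 : 0 < x := inv_pos.2 (by linarith)
  have hx4 : x ≤ 4⁻¹ := inv_anti₀ (by norm_num) hn
  have h1 : (n : ℝ) * (1 - x) < trainSize n + 1 := Nat.lt_floor_add_one _
  have h2 : 1 ≤ n * x := by
    rw [hx, ← div_eq_mul_inv, le_div_iff₀ (by linarith), one_mul]
    exact (Real.log_le_sub_one_of_pos hn0).trans (by linarith)
  have h3 : (n : ℝ) * (1 - 2 * x) ≤ trainSize n := by nlinarith
  have h4 : (n : ℝ) ≤ n * (1 - 2 * x) * (1 + 4 * x) := by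
    nlinarith [mul_nonneg hn0.le (mul_nonneg hx0.le (by linarith : 0 ≤ 1 - 4 * x))]
  exact h4.trans (mul_le_mul_of_nonneg_right h3 (by linarith))

theorem half_le_trainSize (hn : 4 ≤ Real.log n) : (n : ℝ) / 2 ≤ trainSize n := by
  have h1 := le_trainSize_mul hn
  have hx4 : (Real.log n)⁻¹ ≤ 4⁻¹ := inv_anti₀ (by norm_num) hn
  have : (0 : ℝ) ≤ trainSize n := Nat.cast_nonneg _
  nlinarith

theorem div_log_le_validSize (hn : 4 ≤ Real.log n) : (n : ℝ) / Real.log n ≤ validSize n := by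
  have hn0 := natCast_pos_of_log hn
  have h1 := trainSize_le hn
  have h2 : (0 : ℝ) < (Real.log n)⁻¹ := inv_pos.2 (by linarith)
  -- Makes the truncated subtraction in `validSize` exact.
  have h3 : trainSize n ≤ n := by
    have : (trainSize n : ℝ) ≤ n := by nlinarith
    exact_mod_cast this
  rw [validSize, Nat.cast_sub h3, div_eq_mul_inv]
  linarith

end Sizes

/-! ### Cardinality and resolution of the grid -/

section Grid

variable {d n : ℕ} {a₀ : ℝ}

theorem smallestBandwidth_pos (hn : 4 ≤ Real.log n) : 0 < smallestBandwidth d n :=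
  Real.rpow_pos_of_pos (mul_pos (natCast_pos_of_log hn) (by linarith)) _

theorem smallestBandwidth_pow (hd : 1 ≤ d) (hn : 4 ≤ Real.log n) :
    smallestBandwidth d n ^ d = (n * Real.log n)⁻¹ := by
  have h0 : 0 < n * Real.log n := mul_pos (natCast_pos_of_log hn) (by linarith)
  have hd0 : (d : ℝ) ≠ 0 := by positivity
  rw [smallestBandwidth, ← Real.rpow_natCast, ← Real.rpow_mul h0.le]
  rw [show -(1 / (d : ℝ)) * d = -1 by field_simp, Real.rpow_neg_one]

theorem one_lt_mul_log (hn : 4 ≤ Real.log n) : 1 < n * Real.log n := by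
  have hn0 := natCast_pos_of_log hn
  have : (1 : ℝ) ≤ n := by exact_mod_cast (by exact_mod_cast hn0 : 0 < n)
  nlinarith

theorem smallestBandwidth_lt_one (hd : 1 ≤ d) (hn : 4 ≤ Real.log n) :
    smallestBandwidth d n < 1 := by
  have hd0 : (0 : ℝ) < d := by positivity
  refine Real.rpow_lt_one_of_one_lt_of_neg (one_lt_mul_log hn) ?_
  rw [neg_lt_zero]; positivity

theorem one_lt_gridStep (ha : 0 < a₀) (hn : 4 ≤ Real.log n) : 1 < gridStep a₀ n := by
  have : 0 < a₀ / Real.log n := div_pos ha (by linarith)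
  rw [gridStep]; linarith

/-- Every geometric grid point below one has an exponent of order `(log n) ^ 2`. -/
theorem le_of_gridPoint_lt_one (hd : 1 ≤ d) (ha : 0 < a₀) (hn : 4 ≤ Real.log n) {j : ℕ}
    (hj : smallestBandwidth d n * gridStep a₀ n ^ j < 1) :
    (j : ℝ) ≤ (2 + 2 / a₀) * Real.log n ^ 2 := by
  have hn0 := natCast_pos_of_log hn
  have hs := one_lt_gridStep ha hn
  have hh := smallestBandwidth_pos (d := d) hn
  have hd1 : (1 : ℝ) ≤ d := by exact_mod_cast hd
  have h1 := Real.log_neg (by positivity) hj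
  rw [Real.log_mul hh.ne' (by positivity), Real.log_pow, smallestBandwidth,
    Real.log_rpow (by nlinarith [one_lt_mul_log hn]),
    Real.log_mul hn0.ne' (by linarith)] at h1
  set Λ := Real.log n with hΛ
  have h2 : Real.log Λ ≤ Λ := (Real.log_le_sub_one_of_pos (by linarith)).trans (by linarith)
  have h3 : (j : ℝ) * Real.log (gridStep a₀ n) ≤ 2 * Λ := by
    have h0 : 0 ≤ Λ + Real.log Λ := add_nonneg (by linarith) (Real.log_nonneg (by linarith))
    have : 1 / (d : ℝ) * (Λ + Real.log Λ) ≤ Λ + Real.log Λ := by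
      rw [one_div]
      exact mul_le_of_le_one_left h0 (inv_le_one_of_one_le₀ hd1)
    nlinarith
  -- From log y ≥ 1 - 1/y at y = 1 + a₀/Λ, then Λ + a₀ ≤ Λ (1 + a₀).
  have h4 : a₀ / (Λ * (1 + a₀)) ≤ Real.log (gridStep a₀ n) := by
    refine le_trans ?_ (Real.one_sub_inv_le_log_of_pos (by linarith))
    have h5 : 1 - (gridStep a₀ n)⁻¹ = a₀ / (Λ + a₀) := by
      rw [gridStep, ← hΛ]
      have : Λ + a₀ ≠ 0 := by positivity
      have : Λ ≠ 0 := by positivity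
      field_simp
      ring
    rw [h5]
    refine div_le_div_of_nonneg_left ha.le (by linarith) ?_
    nlinarith
  have h5 : (j : ℝ) * (a₀ / (Λ * (1 + a₀))) ≤ 2 * Λ :=
    (mul_le_mul_of_nonneg_left h4 (Nat.cast_nonneg j)).trans h3
  have h6 : 0 < a₀ / (Λ * (1 + a₀)) := by
    have : 0 < Λ := by linarith
    positivity
  rw [← le_div_iff₀ h6] at h5
  refine h5.trans (le_of_eq ?_)
  have : Λ ≠ 0 := by positivity
  field_simp
  ring

/-- The largest exponent of the geometric part of the grid. -/
theorem exists_gridSize (hd : 1 ≤ d) (ha : 0 < a₀) (hn : 4 ≤ Real.log n) :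
    ∃ k : ℕ, gridSize d a₀ n = k + 2 ∧ smallestBandwidth d n * gridStep a₀ n ^ k < 1 ∧
      1 ≤ smallestBandwidth d n * gridStep a₀ n ^ (k + 1) := by
  set J : Set ℕ := {j : ℕ | smallestBandwidth d n * gridStep a₀ n ^ j < 1} with hJ
  -- Without a bound, `sSup` in ℕ would be the default value 0 rather than a maximum.
  have hbdd : BddAbove J := by
    refine ⟨⌈(2 + 2 / a₀) * Real.log n ^ 2⌉₊, fun j hj => ?_⟩
    exact_mod_cast (le_of_gridPoint_lt_one hd ha hn hj).trans (Nat.le_ceil _)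
  have hne : J.Nonempty := ⟨0, by simpa [hJ] using smallestBandwidth_lt_one hd hn⟩
  refine ⟨sSup J, rfl, Nat.sSup_mem hne hbdd, ?_⟩
  by_contra hlt
  have : sSup J + 1 ≤ sSup J := le_csSup hbdd (not_le.1 hlt)
  omega

theorem gridSize_le (hd : 1 ≤ d) (ha : 0 < a₀) (hn : 4 ≤ Real.log n) :
    (gridSize d a₀ n : ℝ) ≤ (4 + 2 / a₀) * Real.log n ^ 2 := by
  obtain ⟨k, hk, hk1, -⟩ := exists_gridSize hd ha hn
  have := le_of_gridPoint_lt_one hd ha hn hk1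
  rw [hk]
  push_cast
  nlinarith

theorem gridBandwidth_pos (ha : 0 < a₀) (hn : 4 ≤ Real.log n) (j : Fin (gridSize d a₀ n)) :
    0 < gridBandwidth d a₀ n j := by
  have := one_lt_gridStep ha hn
  have := smallestBandwidth_pos (d := d) hn
  rw [gridBandwidth]
  split_ifs
  · exact one_pos
  · positivity

theorem exists_gridBandwidth_eq_one :
    ∃ j : Fin (gridSize d a₀ n), gridBandwidth d a₀ n j = 1 :=
  ⟨⟨gridSize d a₀ n - 1, by rw [gridSize]; omega⟩,
    if_pos (Nat.sub_add_cancel (by rw [gridSize]; omega))⟩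

/-- The grid approximates every bandwidth in its range from below. -/
theorem exists_gridBandwidth_le (hd : 1 ≤ d) (ha : 0 < a₀) (hn : 4 ≤ Real.log n) {h : ℝ}
    (h0 : smallestBandwidth d n ≤ h) (h1 : h < 1) :
    ∃ j : Fin (gridSize d a₀ n), gridBandwidth d a₀ n j ≤ h ∧
      h ≤ gridStep a₀ n * gridBandwidth d a₀ n j := by
  classical
  obtain ⟨k, hk, -, hk2⟩ := exists_gridSize hd ha hn
  set i := Nat.findGreatest (fun i => gridStep a₀ n ^ i * smallestBandwidth d n ≤ h) k with hi
  have hik : i ≤ k := Nat.findGreatest_le k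
  have hP : gridStep a₀ n ^ i * smallestBandwidth d n ≤ h :=
    Nat.findGreatest_spec (P := fun i => gridStep a₀ n ^ i * smallestBandwidth d n ≤ h)
      (Nat.zero_le k) (by simpa using h0)
  have hb : gridBandwidth d a₀ n ⟨i, by omega⟩ = gridStep a₀ n ^ i * smallestBandwidth d n :=
    if_neg (by simp only; omega)
  refine ⟨⟨i, by omega⟩, by rwa [hb], ?_⟩
  rw [hb, ← mul_assoc, ← pow_succ']
  -- At the last geometric point the next one is at least 1 > h; before it, maximality of `i`
  -- applies.
  rcases hik.eq_or_lt with heq | hlt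
  · rw [heq, mul_comm]
    linarith
  · exact (not_le.1 (Nat.findGreatest_is_greatest (P := fun i =>
      gridStep a₀ n ^ i * smallestBandwidth d n ≤ h) (Nat.lt_succ_self i) hlt)).le

/-- A convex function of x on [0, 1] lies below its chord. -/
theorem one_add_mul_pow_le {a x : ℝ} (ha : 0 ≤ a) (hx : 0 ≤ x) (hx1 : x ≤ 1) (d : ℕ) :
    (1 + a * x) ^ d ≤ 1 + ((1 + a) ^ d - 1) * x := by
  induction d with
  | zero => simp
  | succ d ih =>
    have h1 : 1 ≤ (1 + a) ^ d := one_le_pow₀ (by linarith)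
    have h2 : 0 ≤ 1 + a * x := by positivity
    calc (1 + a * x) ^ (d + 1) = (1 + a * x) ^ d * (1 + a * x) := pow_succ _ _
      _ ≤ (1 + ((1 + a) ^ d - 1) * x) * (1 + a * x) := mul_le_mul_of_nonneg_right ih h2
      _ ≤ 1 + ((1 + a) ^ (d + 1) - 1) * x := by
        rw [pow_succ]
        nlinarith [mul_nonneg (mul_nonneg (sub_nonneg.2 h1) ha) (mul_nonneg hx (sub_nonneg.2 hx1))]

/-- The inflation factor of the oracle inequality. -/
theorem gridStep_pow_mul_le (ha : 0 < a₀) (hn : 4 ≤ Real.log n) :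
    gridStep a₀ n ^ d * (1 + 4 * (Real.log n)⁻¹) ≤ 1 + 5 * (1 + a₀) ^ d / Real.log n := by
  set x := (Real.log n)⁻¹ with hx
  have hx0 : 0 < x := inv_pos.2 (by linarith)
  have hx4 : x ≤ 4⁻¹ := inv_anti₀ (by norm_num) hn
  have h1 := one_add_mul_pow_le ha.le hx0.le (by linarith) d
  have h2 : 1 ≤ (1 + a₀) ^ d := one_le_pow₀ (by linarith)
  rw [gridStep, div_eq_mul_inv, div_eq_mul_inv, ← hx]
  set c := (1 + a₀) ^ d
  -- As 4x ≤ 1, the product is at most 1 + (2c + 2) x, and 2c + 2 ≤ 5c because c ≥ 1.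
  calc (1 + a₀ * x) ^ d * (1 + 4 * x) ≤ (1 + (c - 1) * x) * (1 + 4 * x) :=
        mul_le_mul_of_nonneg_right h1 (by linarith)
    _ ≤ 1 + 5 * c * x := by
        nlinarith [mul_nonneg (mul_nonneg (sub_nonneg.2 h2) hx0.le)
          (by linarith : 0 ≤ 1 - 4 * x), mul_nonneg (sub_nonneg.2 h2) hx0.le]

end Grid

/-! ### Comparison of the grid with an arbitrary bandwidth -/

section Oracle

variable {d n : ℕ} {a₀ L cl cu : ℝ} {p K : Space d → ℝ}

/-- Some bandwidth of the grid is nearly as good for the training sample as an arbitrary bandwidth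
for the whole sample. -/
theorem IsBoundedDensity.exists_grid_risk_le (hp : IsBoundedDensity d L p) (hL : 0 < L)
    (hcl : 0 < cl) (hd : 1 ≤ d) (ha : 0 < a₀) (hK : IsAdmissibleKernel K) (hKl : cl < l2Norm K)
    (hKu : l2Norm K < cu) (hn : 4 ≤ Real.log n) (hn2 : 2 * L / cl ^ 2 ≤ Real.log n)
    {h : ℝ} (hh : 0 < h) :
    ∃ j : Fin (gridSize d a₀ n),
      risk (fun Z : Fin (trainSize n) → Space d =>
          kernelEstimator K (gridBandwidth d a₀ n j) Z) p
        ≤ ENNReal.ofReal (1 + 5 * (1 + a₀) ^ d / Real.log n) *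
            risk (fun X : Fin n → Space d => kernelEstimator K h X) p
          + ENNReal.ofReal (((1 + 5 * (1 + a₀) ^ d) * L + 2 * cu ^ 2) / n) := by
  obtain ⟨hK2, Φ, hΦ, hΦ1, hmono⟩ := hK
  have hn0 := natCast_pos_of_log hn
  have hnne : n ≠ 0 := by exact_mod_cast hn0.ne'
  have hn1 : (1 : ℝ) ≤ n := by exact_mod_cast Nat.pos_of_ne_zero hnne
  have hΛ : 0 < Real.log n := by linarith
  have hm0 : (0 : ℝ) < trainSize n := lt_of_lt_of_le (by linarith) (half_le_trainSize hn)
  have hmne : trainSize n ≠ 0 := by exact_mod_cast hm0.ne'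
  have hlow := hp.le_risk_kernelEstimator hL.le hnne hK2 hΦ hΦ1 hh
  have hup := fun {h'} (hh' : 0 < h') => hp.risk_kernelEstimator_le hL.le hmne hK2 hΦ hh'
  set R := risk (fun X : Fin n → Space d => kernelEstimator K h X) p
  set C : ℝ := 5 * (1 + a₀) ^ d with hC
  have hC0 : 0 < C := by positivity
  have hCΛ : C / Real.log n ≤ C := div_le_self hC0.le (by linarith)
  have hCΛ0 : 0 < C / Real.log n := div_pos hC0 hΛ
  have hV : l2Norm K ^ 2 ≤ cu ^ 2 := by
    have := hcl.trans hKl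
    gcongr
  have hVm : l2Norm K ^ 2 / 1 ^ d / trainSize n ≤ 2 * cu ^ 2 / n := by
    rw [one_pow, div_one]
    calc l2Norm K ^ 2 / trainSize n ≤ cu ^ 2 / (n / 2) :=
          div_le_div₀ (sq_nonneg _) hV (by linarith) (half_le_trainSize hn)
      _ = 2 * cu ^ 2 / n := by field_simp
  have hfac : R ≤ ENNReal.ofReal (1 + C / Real.log n) * R := by
    refine le_mul_of_one_le_left' ?_
    rw [ENNReal.one_le_ofReal]
    linarith
  -- Bandwidth one has variance at most 2 cu² / n, so only its bias must be compared with `R`.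
  have hone : bias Φ p 1 ≤ R + ENNReal.ofReal (L / n) →
      ∃ j : Fin (gridSize d a₀ n),
      risk (fun Z : Fin (trainSize n) → Space d =>
          kernelEstimator K (gridBandwidth d a₀ n j) Z) p
        ≤ ENNReal.ofReal (1 + C / Real.log n) * R
          + ENNReal.ofReal (((1 + C) * L + 2 * cu ^ 2) / n) := by
    intro hb
    obtain ⟨j, hj⟩ := exists_gridBandwidth_eq_one (d := d) (n := n) (a₀ := a₀)
    refine ⟨j, ?_⟩
    rw [hj]
    calc _ ≤ bias Φ p 1 + ENNReal.ofReal (l2Norm K ^ 2 / 1 ^ d / trainSize n) := hup one_pos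
      _ ≤ (R + ENNReal.ofReal (L / n)) + ENNReal.ofReal (2 * cu ^ 2 / n) := by gcongr
      _ = R + ENNReal.ofReal ((L + 2 * cu ^ 2) / n) := by
          rw [add_assoc, ← ENNReal.ofReal_add (by positivity) (by positivity), add_div]
      _ ≤ _ := by
          gcongr
          nlinarith
  rcases le_or_gt 1 h with h1 | h1
  · refine hone (le_trans ?_ (le_trans le_self_add hlow))
    exact bias_mono hΦ1 hmono one_pos h1
  rcases lt_or_ge h (smallestBandwidth d n) with h0 | h0
  · refine hone ((hp.bias_le hL.le hΦ1 1).trans (le_trans ?_ le_self_add))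
    -- Here h^d n < 1 / log n, so the variance term at h exceeds cl² log n ≥ 2L. Hence R ≥ L, which
    -- bounds every bias.
    have e1 : 2 * L ≤ l2Norm K ^ 2 / h ^ d / n := by
      have e2 : h ^ d ≤ (n * Real.log n)⁻¹ := by
        rw [← smallestBandwidth_pow hd hn]
        gcongr
      have e3 : cl ^ 2 ≤ l2Norm K ^ 2 := by gcongr
      rw [div_div, le_div_iff₀ (by positivity)]
      have e4 : h ^ d * n ≤ (Real.log n)⁻¹ := by
        calc h ^ d * n ≤ (n * Real.log n)⁻¹ * n := by gcongr
          _ = (Real.log n)⁻¹ := by field_simp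
      calc 2 * L * (h ^ d * n) ≤ 2 * L * (Real.log n)⁻¹ := by gcongr
        _ ≤ cl ^ 2 := by
          rw [← div_eq_mul_inv, div_le_iff₀ hΛ]
          rwa [div_le_iff₀' (by positivity)] at hn2
        _ ≤ _ := e3
    have e2 : ENNReal.ofReal L + ENNReal.ofReal L ≤ R + ENNReal.ofReal L := by
      rw [← ENNReal.ofReal_add hL.le hL.le, ← two_mul]
      calc ENNReal.ofReal (2 * L) ≤ ENNReal.ofReal (l2Norm K ^ 2 / h ^ d / n) :=
            ENNReal.ofReal_le_ofReal e1
        _ ≤ R + ENNReal.ofReal (L / n) := le_trans le_add_self hlow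
        _ ≤ R + ENNReal.ofReal L := by
            gcongr
            exact div_le_self hL.le hn1
    exact (ENNReal.add_le_add_iff_right ENNReal.ofReal_ne_top).1 e2
  · obtain ⟨j, hj1, hj2⟩ := exists_gridBandwidth_le hd ha hn h0 h1
    have hg := gridBandwidth_pos ha hn j
    set g := gridBandwidth d a₀ n j
    have hs := one_lt_gridStep ha hn
    set A : ℝ := gridStep a₀ n ^ d * (1 + 4 * (Real.log n)⁻¹) with hA
    have hA1 : 1 ≤ A := by
      have h2 : 0 < (Real.log n)⁻¹ := inv_pos.2 hΛ
      exact one_le_mul_of_one_le_of_one_le (one_le_pow₀ hs.le) (by linarith)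
    have hAC : A ≤ 1 + C / Real.log n := gridStep_pow_mul_le ha hn
    -- Rounding down costs (h/g)^d and the smaller sample costs n/m; together at most `A`.
    have hvar : l2Norm K ^ 2 / g ^ d / trainSize n ≤ A * (l2Norm K ^ 2 / h ^ d / n) := by
      have e1 : h ^ d ≤ gridStep a₀ n ^ d * g ^ d := by
        rw [← mul_pow]
        gcongr
      have e2 := le_trainSize_mul hn
      have e3 : h ^ d * n ≤ A * (g ^ d * trainSize n) := by
        calc h ^ d * n ≤ (gridStep a₀ n ^ d * g ^ d) * (trainSize n * (1 + 4 * (Real.log n)⁻¹)) := by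
              gcongr
          _ = _ := by rw [hA]; ring
      rw [div_div, div_div, ← mul_div_assoc, div_le_div_iff₀ (by positivity) (by positivity)]
      nlinarith [mul_le_mul_of_nonneg_left e3 (sq_nonneg (l2Norm K))]
    refine ⟨j, ?_⟩
    calc _ ≤ bias Φ p g + ENNReal.ofReal (l2Norm K ^ 2 / g ^ d / trainSize n) := hup hg
      _ ≤ ENNReal.ofReal A * bias Φ p h
          + ENNReal.ofReal A * ENNReal.ofReal (l2Norm K ^ 2 / h ^ d / n) := by
          refine add_le_add ((bias_mono hΦ1 hmono hg hj1).trans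
            (le_mul_of_one_le_left' (ENNReal.one_le_ofReal.2 hA1))) ?_
          rw [← ENNReal.ofReal_mul (by linarith)]
          exact ENNReal.ofReal_le_ofReal hvar
      _ ≤ ENNReal.ofReal (1 + C / Real.log n) * (R + ENNReal.ofReal (L / n)) := by
          rw [← mul_add]
          gcongr
      _ ≤ _ := by
          rw [mul_add, ← ENNReal.ofReal_mul (by linarith)]
          gcongr
          rw [← mul_div_assoc]
          gcongr
          nlinarith [sq_nonneg cu]

end Oracle

end DensityAggregation

end

/-! ### The corollary -/

open DensityAggregation in
theorem corollary6p2 :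
    ∃ (n₁ : ℝ → ℝ → ℝ → ℕ) (c₅ : ℕ → ℝ → ℝ) (c₇ : ℝ → ℝ → ℝ → ℕ → ℝ → ℝ),
      (∀ L cl cu, 4 ≤ n₁ L cl cu) ∧
      (∀ d a₀, 0 < c₅ d a₀) ∧
      (∀ L cl cu d a₀, 0 < c₇ L cl cu d a₀) ∧
      ∀ (L cl cu : ℝ) (d : ℕ) (a₀ : ℝ), 0 < L → 0 < cl → cl < cu → 1 ≤ d → 0 < a₀ →
      ∀ (p : Space d → ℝ), IsBoundedDensity d L p →
      ∀ (N : ℕ), 1 ≤ N →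
      ∀ (K : Fin N → Space d → ℝ), (∀ j, IsAdmissibleKernel (K j)) →
        (∀ j, cl < l2Norm (K j) ∧ l2Norm (K j) < cu) →
      ∀ (n : ℕ), n₁ L cl cu ≤ n →
      ∀ (𝒮 : Finset (Split n (trainSize n) (validSize n))), 𝒮.Nonempty →
      ∀ (kind : Kind) (T : (Fin n → Space d) → Space d → ℝ), IsKernelAggregate kind a₀ K 𝒮 T →
        risk T p ≤
          ENNReal.ofReal (1 + c₅ d a₀ / Real.log n) *
              (⨅ (j : Fin N) (h : ℝ) (_ : 0 < h),
                risk (fun X : Fin n → Space d => kernelEstimator (K j) h X) p)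
            + ENNReal.ofReal (c₇ L cl cu d a₀ * (N * Real.log n ^ 3 / n)) := by
  -- The exponentials in n₁ force log n ≥ 4 and log n ≥ 2L / cl². The absolute values and the final
  -- `+ 1` only serve positivity at all real arguments.
  refine ⟨fun L cl cu => ⌈Real.exp 4⌉₊ + 4 + ⌈Real.exp (2 * L / cl ^ 2)⌉₊,
    fun d a₀ => 5 * (1 + |a₀|) ^ d,
    fun L cl cu d a₀ => (1 + 5 * (1 + |a₀|) ^ d) * |L| + 2 * cu ^ 2 + |L| * (4 + 2 / |a₀|) + 1,
    fun L cl cu => by dsimp only; omega, fun d a₀ => by positivity, fun L cl cu d a₀ => by positivity, ?_⟩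
  intro L cl cu d a₀ hL hcl _ hd ha p hp N hN K hK hKn n hn 𝒮 h𝒮 kind T hT
  dsimp only at hn ⊢
  rw [abs_of_pos ha, abs_of_pos hL]
  have hn' : (⌈Real.exp 4⌉₊ : ℝ) + 4 + ⌈Real.exp (2 * L / cl ^ 2)⌉₊ ≤ n := by exact_mod_cast hn
  have hc1 : (0 : ℝ) ≤ ⌈Real.exp 4⌉₊ := Nat.cast_nonneg _
  have hc2 : (0 : ℝ) ≤ ⌈Real.exp (2 * L / cl ^ 2)⌉₊ := Nat.cast_nonneg _
  have hn0 : (0 : ℝ) < n := by linarith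
  have hlog : 4 ≤ Real.log n :=
    (Real.le_log_iff_exp_le hn0).2 ((Nat.le_ceil _).trans (by linarith))
  have hlog2 : 2 * L / cl ^ 2 ≤ Real.log n :=
    (Real.le_log_iff_exp_le hn0).2 ((Nat.le_ceil _).trans (by linarith))
  have hΛ : 0 < Real.log n := by linarith
  have hm0 : (0 : ℝ) < trainSize n := lt_of_lt_of_le (by linarith) (half_le_trainSize hlog)
  have hvl := div_log_le_validSize hlog
  have hl0 : (0 : ℝ) < validSize n := lt_of_lt_of_le (by positivity) hvl
  set C : ℝ := 5 * (1 + a₀) ^ d with hC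
  have hC0 : 0 < C := by positivity
  set B : ℝ := 4 + 2 / a₀ with hB
  have hB0 : 0 < B := by positivity
  -- There are N M functions, with M ≤ B (log n)² and ℓ ≥ n / log n; the remainder of the grid
  -- comparison is of smaller order 1/n.
  have hrate : ((1 + C) * L + 2 * cu ^ 2) / n
        + L * Fintype.card (Fin N × Fin (gridSize d a₀ n)) / validSize n
      ≤ ((1 + C) * L + 2 * cu ^ 2 + L * B + 1) * (N * Real.log n ^ 3 / n) := by
    have hN1 : (1 : ℝ) ≤ N := by exact_mod_cast hN
    have e1 : (1 : ℝ) ≤ N * Real.log n ^ 3 :=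
      one_le_mul_of_one_le_of_one_le hN1 (one_le_pow₀ (by linarith))
    have e2 : L * Fintype.card (Fin N × Fin (gridSize d a₀ n)) / validSize n
        ≤ L * B * (N * Real.log n ^ 3) / n := by
      rw [Fintype.card_prod, Fintype.card_fin, Fintype.card_fin]
      push_cast
      calc L * (N * gridSize d a₀ n) / validSize n
          ≤ L * (N * (B * Real.log n ^ 2)) / (n / Real.log n) := by
            gcongr
            exact gridSize_le hd ha hlog
        _ = L * B * (N * Real.log n ^ 3) / n := by field_simp
    have e3 : (1 + C) * L + 2 * cu ^ 2 ≤ ((1 + C) * L + 2 * cu ^ 2) * (N * Real.log n ^ 3) :=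
      le_mul_of_one_le_right (by positivity) e1
    calc _ ≤ ((1 + C) * L + 2 * cu ^ 2) * (N * Real.log n ^ 3) / n
          + L * B * (N * Real.log n ^ 3) / n := by gcongr
      _ ≤ (((1 + C) * L + 2 * cu ^ 2) * (N * Real.log n ^ 3)
          + L * B * (N * Real.log n ^ 3) + 1 * (N * Real.log n ^ 3)) / n := by
          rw [← add_div]
          exact div_le_div_of_nonneg_right (by linarith) hn0.le
      _ = _ := by ring
  have hmain : ∀ (j : Fin N) (h : ℝ), 0 < h →
      risk T p ≤ ENNReal.ofReal (1 + C / Real.log n) *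
          risk (fun X : Fin n → Space d => kernelEstimator (K j) h X) p
        + ENNReal.ofReal (((1 + C) * L + 2 * cu ^ 2 + L * B + 1) * (N * Real.log n ^ 3 / n)) := by
    intro j h hh
    obtain ⟨k, hk⟩ := hp.exists_grid_risk_le hL hcl hd ha (hK j) (hKn j).1 (hKn j).2 hlog hlog2 hh
    have h1 := hp.risk_averagedAggregate_le hL.le (by exact_mod_cast hm0.ne')
      (by exact_mod_cast hl0.ne') (fun i : Fin N × Fin (gridSize d a₀ n) => (hK i.1).1)
      (fun i => (hK i.1).2.imp fun _ hΦ => hΦ.1) (fun i => gridBandwidth_pos ha hlog i.2)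
      h𝒮 hT (j, k)
    refine h1.trans ((add_le_add_left hk _).trans ?_)
    rw [add_assoc, ← ENNReal.ofReal_add (by positivity) (by positivity)]
    gcongr
  have hc0 : ENNReal.ofReal (1 + C / Real.log n) ≠ 0 := by
    rw [Ne, ENNReal.ofReal_eq_zero, not_le]
    positivity
  -- Subtracting the additive term leaves a lower bound to verify for each kernel and bandwidth; a
  -- nonzero finite factor passes through the infima.
  rw [← tsub_le_iff_right, ENNReal.mul_iInf_of_ne hc0 ENNReal.ofReal_ne_top]
  refine le_iInf fun j => ?_
  rw [ENNReal.mul_iInf_of_ne hc0 ENNReal.ofReal_ne_top]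
  refine le_iInf fun h => ?_
  rw [ENNReal.mul_iInf_of_ne hc0 ENNReal.ofReal_ne_top]
  refine le_iInf fun hh => ?_
  rw [tsub_le_iff_right]
  exact hmain j h hh
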